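/- Let $n\ge 3$ and let $T$ be the $(n,2)$-biregular tree: the tree with a proper $2$-colouring of its vertices in which the vertices of one colour (blue) have degree $n$ and those of the other colour (red) have degree $2$. Let $G=\mathrm{Aut}(T)$ with the compact-open topology (pointwise convergence on vertices), and let $\mu$ be the Haar measure on $G$ in Serre's normalisation with respect to the vertex set $V(T)$, i.e. $\sum_{v\in G\backslash V(T)}\mu(G_v)^{-1}=1$; this is the scaling for which $\mu(\Gamma\backslash G)=\sum_{v\in\Gamma\backslash V(T)}1/|\Gamma_v|$ for discrete $\Gamma\le G$. A uniform lattice in $G$ is a discrete subgroup $\Gamma$ with $\Gamma\backslash G$ compact. Such a $\mu$ exists, and the following hold. 1. The set $\{\mu(\Gamma\backslash G) : \Gamma \text{ a uniform lattice in } G\}\subset\mathbb{R}$ is not discrete (in the subspace topology). 2. For every integer $k\ge 0$ let $(\mathcal G,A)_k$ be the following graph of groups. The graph is a path $r_0 - b_0 - r_1 - b_1 - \cdots - r_k - b_k$. The vertex groups are $C_2$ at $r_0$; $C_{n-1}^i$ at $r_i$ for $1\le i\le k$; $C_{n-1}^{i+1}$ at $b_i$ for $0\le i<k$; and $C_n\times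 C_{n-1}^k$ at $b_k$. The edge group is $C_{n-1}^i$ on $r_i - b_i$ (trivial for $i=0$) and $C_{n-1}^{i+1}$ on $b_i - r_{i+1}$, and all monomorphisms are the natural inclusions. Then there is a uniform lattice $\Gamma_k\le G$ acting on $T$ with quotient graph of groups $(\mathcal G,A)_k$ (so $\Gamma_k\cong\pi_1((\mathcal G,A)_k)$, with universal cover $T$), and $$\mu(\Gamma_k\backslash G)=x_k:=\frac12+2\sum_{i=1}^k\frac1{(n-1)^i}+\frac1{n(n-1)^k}.$$ 3. $x_k\to x:=\frac12+\frac2{n-2}$ as $k\to\infty$, with rate of convergence $\lim_{k\to\infty}\frac{|x_{k+1}-x|}{|x_k-x|}=\frac1{n-1}$. 4. The limit $x$ is itself the covolume of a uniform lattice in $G$, namely one acting on $T$ with quotient graph of groups the star with central vertex group $C_{n-2}$ and three leaves with groups $C_2\times C_{n-2}$, $C_2$, $C_2\times C_{n-2}$, joined to the centre by edges with groups $C_{n-2}$, $1$, $C_{n-2}$ respectively, all monomorphisms being natural inclusions. -/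

import Mathlib

open Filter Topology MeasureTheory

universe u

/-! ### Biregular trees and their automorphism groups -/

/-- `T` is an `(n, m)`-biregular tree: a tree with a proper 2-colouring of its vertices such that
the vertices of one colour have exactly `n` neighbours and those of the other exactly `m`. -/
structure SimpleGraph.IsBiregularTree {V : Type u} (T : SimpleGraph V) (n m : ℕ) : Prop where
  isTree : T.IsTree
  biregular : ∃ c : T.Coloring Bool, ∀ v : V, (T.neighborSet v).encard = if c v then n else m

/-- The topology of pointwise convergence on the vertex set (with `V` discrete). On the
automorphism group of a connected locally finite tree this is the compact-open topology. -/
instance SimpleGraph.autTopology {V : Type u} (T : SimpleGraph V) : TopologicalSpace (T ≃g T) :=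
  TopologicalSpace.induced (fun g : T ≃g T => (g : V → V))
    (@Pi.topologicalSpace V (fun _ => V) (fun _ => ⊥))

/-- The Borel σ-algebra on the automorphism group. -/
instance SimpleGraph.autMeasurableSpace {V : Type u} (T : SimpleGraph V) :
    MeasurableSpace (T ≃g T) := borel (T ≃g T)

instance SimpleGraph.autBorelSpace {V : Type u} (T : SimpleGraph V) : BorelSpace (T ≃g T) := ⟨rfl⟩

/-! ### Uniform lattices and covolumes -/

/-- A uniform lattice in a topological group `G`: a discrete subgroup `Γ` such that the coset
space `Γ \ G` is compact. -/
structure IsUniformLattice {G : Type u} [Group G] [TopologicalSpace G] (Γ : Subgroup G) : Prop where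
  discrete : DiscreteTopology Γ
  cocompact : CompactSpace (Quotient (QuotientGroup.rightRel Γ))

/-- Serre's normalisation of the Haar measure of `G = Aut T` with respect to the `G`-set of
vertices: `∑_{v ∈ G \ V} 1 / μ(G_v) = 1`. Since `μ(Γ \ G) · μ(G_v)⁻¹` is the sum of
`1 / |Γ_w|` over representatives `w` of the `Γ`-orbits in `G v`, this is the scaling for which
`μ(Γ \ G) = ∑_{v ∈ Γ \ V} 1 / |Γ_v|` for discrete subgroups `Γ`. -/
structure SimpleGraph.IsSerreHaar {V : Type u} (T : SimpleGraph V) (μ : Measure (T ≃g T)) :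
    Prop where
  isHaar : μ.IsHaarMeasure
  normalized : ∑' o : MulAction.orbitRel.Quotient (T ≃g T) V,
    (μ (MulAction.stabilizer (T ≃g T) o.out : Set (T ≃g T)))⁻¹ = 1

/-- The set of covolumes `μ(Γ \ Aut T)` of uniform lattices `Γ` in `Aut T`. -/
def SimpleGraph.uniformCovolumes {V : Type u} (T : SimpleGraph V) (μ : Measure (T ≃g T)) : Set ℝ :=
  {x | ∃ Γ : Subgroup (T ≃g T), IsUniformLattice Γ ∧ x = (covolume Γ (T ≃g T) μ).toReal}

/-! ### Graphs of groups -/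

/-- A graph of groups. Each (geometric) edge `e` has two ends, indexed by `Bool`. -/
structure GraphOfGroups where
  Vert : Type
  Edge : Type
  endpoint : Edge → Bool → Vert
  vertGroup : Vert → Type
  edgeGroup : Edge → Type
  [instVert : ∀ a, Group (vertGroup a)]
  [instEdge : ∀ e, Group (edgeGroup e)]
  mono : ∀ e s, edgeGroup e →* vertGroup (endpoint e s)
  mono_injective : ∀ e s, Function.Injective (mono e s)

attribute [instance] GraphOfGroups.instVert GraphOfGroups.instEdge

/-- An identification of a graph of groups `𝒢` with the quotient graph of groups of a group `Γ` of
automorphisms of the tree `T` acting without inversions. By Bass–Serre theory this says that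
`Γ` is the fundamental group of `𝒢`, acting on its universal cover `T`. -/
structure GraphOfGroups.QuotientPresentation (𝒢 : GraphOfGroups) {V : Type u} (T : SimpleGraph V)
    (Γ : Subgroup (T ≃g T)) where
  no_inversion : ∀ γ : Γ, ∀ u v : V, T.Adj u v → ¬ (γ • u = v ∧ γ • v = u)
  /-- a lift of each vertex -/
  vert : 𝒢.Vert → V
  /-- a lift of each edge, given by its two ends -/
  edge : 𝒢.Edge → Bool → V
  edge_adj : ∀ e, T.Adj (edge e false) (edge e true)
  /-- every vertex of `T` lies over exactly one vertex of `𝒢` -/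
  vert_unique : ∀ v : V, ∃! a : 𝒢.Vert, ∃ γ : Γ, γ • vert a = v
  /-- every edge of `T` lies over exactly one edge of `𝒢` -/
  edge_unique : ∀ u v : V, T.Adj u v → ∃! e : 𝒢.Edge, ∃ γ : Γ,
    (γ • edge e false = u ∧ γ • edge e true = v) ∨ (γ • edge e false = v ∧ γ • edge e true = u)
  /-- elements carrying the ends of the lifted edges to the lifted vertices -/
  elt : 𝒢.Edge → Bool → Γ
  elt_smul : ∀ e s, elt e s • edge e s = vert (𝒢.endpoint e s)
  /-- the vertex groups are the stabilisers of the lifted vertices -/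
  vertEquiv : ∀ a, MulAction.stabilizer Γ (vert a) ≃* 𝒢.vertGroup a
  /-- the edge groups are the stabilisers of the lifted edges -/
  edgeEquiv : ∀ e, ↥(MulAction.stabilizer Γ (edge e false) ⊓ MulAction.stabilizer Γ (edge e true)) ≃*
    𝒢.edgeGroup e
  /-- the monomorphisms are the inclusions of stabilisers, followed by conjugation by `elt` -/
  mono_eq : ∀ (e : 𝒢.Edge) (s : Bool)
    (x : ↥(MulAction.stabilizer Γ (edge e false) ⊓ MulAction.stabilizer Γ (edge e true)))
    (y : MulAction.stabilizer Γ (vert (𝒢.endpoint e s))),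
    (y : Γ) = elt e s * x * (elt e s)⁻¹ →
      vertEquiv (𝒢.endpoint e s) y = 𝒢.mono e s (edgeEquiv e x)

/-- `Γ` acts on `T` with quotient graph of groups `𝒢`. -/
def GraphOfGroups.IsQuotientOf (𝒢 : GraphOfGroups) {V : Type u} (T : SimpleGraph V)
    (Γ : Subgroup (T ≃g T)) : Prop :=
  Nonempty (𝒢.QuotientPresentation T Γ)

/-- The multiplicative cyclic group of order `m` (for `m ≥ 1`). -/
abbrev Cyc (m : ℕ) : Type := Multiplicative (ZMod m)

/-! ### The path of groups

The underlying graph is the path `r₀ — b₀ — r₁ — b₁ — ⋯ — r_k — b_k`. The groups are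
`r₀ : C₂`, `r_i : C_{n-1}^i` for `1 ≤ i`, `b_i : C_{n-1}^{i+1}` for `i < k`, and
`b_k : C_n × C_{n-1}^k`; the edge `r_i — b_i` has group `C_{n-1}^i` and the edge
`b_i — r_{i+1}` has group `C_{n-1}^{i+1}`. All groups are realised as coordinate subgroups of
`C₂ × C_n × C_{n-1}^k`, and the monomorphisms are the inclusions. -/

namespace CyclicPath

inductive Vert (k : ℕ) : Type
  | red (i : Fin (k + 1)) : Vert k
  | blue (i : Fin (k + 1)) : Vert k

inductive Edge (k : ℕ) : Type
  /-- the edge `r_i — b_i` -/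
  | up (i : Fin (k + 1)) : Edge k
  /-- the edge `b_i — r_{i+1}` -/
  | flat (i : Fin k) : Edge k

/-- The end `false` of an edge is red, the end `true` is blue. -/
def endpoint (k : ℕ) : Edge k → Bool → Vert k
  | .up i, false => .red i
  | .up i, true => .blue i
  | .flat i, false => .red i.succ
  | .flat i, true => .blue i.castSucc

/-- The ambient group `C₂ × C_n × C_{n-1}^k`. -/
abbrev Ambient (n k : ℕ) : Type := Cyc 2 × Cyc n × (Fin k → Cyc (n - 1))

/-- `C_{n-1}^i` as the subgroup of the first `i` coordinates of `C_{n-1}^k` (for `i ≤ k`). -/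
def cycPow (n k i : ℕ) : Subgroup (Ambient n k) :=
  (⊥ : Subgroup (Cyc 2)).prod ((⊥ : Subgroup (Cyc n)).prod
    (Subgroup.pi {j : Fin k | i ≤ (j : ℕ)} fun _ => ⊥))

def vertSubgroup (n k : ℕ) : Vert k → Subgroup (Ambient n k)
  | .red i => if (i : ℕ) = 0 then (⊤ : Subgroup (Cyc 2)).prod ⊥ else cycPow n k i
  | .blue i => if (i : ℕ) = k then (⊥ : Subgroup (Cyc 2)).prod ⊤ else cycPow n k (i + 1)

def edgeSubgroup (n k : ℕ) : Edge k → Subgroup (Ambient n k)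
  | .up i => cycPow n k i
  | .flat i => cycPow n k (i + 1)

theorem edgeSubgroup_le (n k : ℕ) (e : Edge k) (s : Bool) :
    edgeSubgroup n k e ≤ vertSubgroup n k (endpoint k e s) := by
  have h_mono : ∀ i, cycPow n k i ≤ cycPow n k (i + 1) := by
    intro i x hx
    simp only [cycPow, Subgroup.mem_prod, Subgroup.mem_pi, Set.mem_ofPred_eq] at hx ⊢
    exact ⟨hx.1, hx.2.1, fun j hj => hx.2.2 j (by omega)⟩
  have h_le : ∀ i, cycPow n k i ≤ (⊥ : Subgroup (Cyc 2)).prod ⊤ := by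
    intro i x hx
    simp only [cycPow, Subgroup.mem_prod] at hx ⊢
    exact ⟨hx.1, Subgroup.mem_top _⟩
  have h_zero : cycPow n k 0 ≤ (⊤ : Subgroup (Cyc 2)).prod ⊥ := by
    intro x hx
    simp only [cycPow, Subgroup.mem_prod, Subgroup.mem_pi, Set.mem_ofPred_eq,
      Subgroup.mem_bot] at hx ⊢
    exact ⟨Subgroup.mem_top _, Prod.ext hx.2.1 (funext fun j => hx.2.2 j (Nat.zero_le _))⟩
  rcases e with i | i <;> cases s
  · by_cases hi : (i : ℕ) = 0
    · simpa [edgeSubgroup, vertSubgroup, endpoint, hi] using h_zero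
    · simp [edgeSubgroup, vertSubgroup, endpoint, hi]
  · by_cases hi : (i : ℕ) = k
    · simpa [edgeSubgroup, vertSubgroup, endpoint, hi] using h_le k
    · simpa [edgeSubgroup, vertSubgroup, endpoint, hi] using h_mono i
  · simp [edgeSubgroup, vertSubgroup, endpoint]
  · have hi : (i : ℕ) ≠ k := i.isLt.ne
    simp [edgeSubgroup, vertSubgroup, endpoint, hi]

end CyclicPath

/-- The path of groups with vertex groups `C₂, C_{n-1}, C_{n-1}, C_{n-1}², C_{n-1}², …,
C_{n-1}^k, C_{n-1}^k, C_n × C_{n-1}^k`. -/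
def cyclicPath (n k : ℕ) : GraphOfGroups where
  Vert := CyclicPath.Vert k
  Edge := CyclicPath.Edge k
  endpoint := CyclicPath.endpoint k
  vertGroup a := CyclicPath.vertSubgroup n k a
  edgeGroup e := CyclicPath.edgeSubgroup n k e
  mono e s := Subgroup.inclusion (CyclicPath.edgeSubgroup_le n k e s)
  mono_injective e s := Subgroup.inclusion_injective (CyclicPath.edgeSubgroup_le n k e s)

/-- The sum of the reciprocals of the orders of the vertex groups of `cyclicPath n k`. -/
noncomputable def pathCovolume (n k : ℕ) : ℝ :=
  1 / 2 + 2 * ∑ i ∈ Finset.Icc 1 k, 1 / ((n : ℝ) - 1) ^ i + 1 / ((n : ℝ) * ((n : ℝ) - 1) ^ k)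

/-! ### The star of groups

A central vertex with group `C_{n-2}` joined to three leaves with groups `C₂ × C_{n-2}`, `C₂`,
`C₂ × C_{n-2}`, by edges with groups `C_{n-2}`, `1`, `C_{n-2}`. The leaf number `1` is the one
with group `C₂`. All groups are realised as subgroups of `C₂ × C_{n-2}`. -/

namespace CyclicStar

inductive Vert : Type
  | center : Vert
  | leaf (i : Fin 3) : Vert

/-- The end `false` of an edge is the leaf, the end `true` is the centre. -/
def endpoint : Fin 3 → Bool → Vert
  | i, false => .leaf i
  | _, true => .center

def vertSubgroup (n : ℕ) : Vert → Subgroup (Cyc 2 × Cyc (n - 2))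
  | .center => (⊥ : Subgroup (Cyc 2)).prod ⊤
  | .leaf i => if i = 1 then (⊤ : Subgroup (Cyc 2)).prod ⊥ else ⊤

def edgeSubgroup (n : ℕ) (i : Fin 3) : Subgroup (Cyc 2 × Cyc (n - 2)) :=
  if i = 1 then ⊥ else (⊥ : Subgroup (Cyc 2)).prod ⊤

theorem edgeSubgroup_le (n : ℕ) (i : Fin 3) (s : Bool) :
    edgeSubgroup n i ≤ vertSubgroup n (endpoint i s) := by
  by_cases hi : i = 1 <;> cases s <;> simp [edgeSubgroup, vertSubgroup, endpoint, hi]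

end CyclicStar

/-- The star of groups with vertex groups `C_{n-2}`, `C₂ × C_{n-2}`, `C₂`, `C₂ × C_{n-2}`. -/
def cyclicStar (n : ℕ) : GraphOfGroups where
  Vert := CyclicStar.Vert
  Edge := Fin 3
  endpoint := CyclicStar.endpoint
  vertGroup a := CyclicStar.vertSubgroup n a
  edgeGroup e := CyclicStar.edgeSubgroup n e
  mono e s := Subgroup.inclusion (CyclicStar.edgeSubgroup_le n e s)
  mono_injective e s := Subgroup.inclusion_injective (CyclicStar.edgeSubgroup_le n e s)

/-!
The graphs of groups `cyclicPath n k` and `cyclicStar n` consist of subgroups of one finite group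
`A`, with each edge group the intersection of the two adjacent vertex groups. This makes Bass–Serre
theory elementary. The cosets of the vertex groups form a finite graph `X` (`cosetGraph`), with
cosets of the edge groups as edges, and `A` acts on `X` with the prescribed quotient and
stabilisers. Counting indices shows that `X` is `(n, 2)`-biregular (`encard_neighborSet_coset`), so
that the tree `T` covers `X` (`IsTree.exists_isCover`): a covering is built outwards from a root,
matching the neighbours of each vertex in turn. By the same construction, every element of `A`
lifts to automorphisms of `T`, and the lifts form the required group `Γ` (`liftGroup`). The map
`Γ → A` identifies the stabilisers in `Γ` with the given subgroups (`isQuotientOf_liftGroup`).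

On the measure side, `Aut T` is a second countable group in which the vertex stabilisers are compact
and open. A discrete subgroup `Γ` then has a Borel fundamental domain `F`. The measure of `F` is
computed by cutting `F` according to where its elements send representatives of the `G`-orbits of
vertices. With Serre's normalisation, the pieces over each `Γ`-orbit have total mass `1 / |Γ_v|`
(`IsFundamentalDomain.measure_eq_tsum_inv_card`), so that the covolume is the sum of the reciprocals
of the orders of the vertex groups (`IsSerreHaar.covolume_eq`). Compactness of `Γ \ G` and existence
of the normalised measure follow from finiteness of the quotient graph.

Finally, `x_k - x` is a nonzero constant times `(n - 1)⁻ᵏ` (`pathCovolume_sub`). This gives the limit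
and the rate of convergence; and since `x` is the covolume of the lattice of the star, it is an
accumulation point of the set of covolumes lying in that set, which is therefore not discrete.
-/

/-! ### Maps out of trees and coverings -/

namespace SimpleGraph

variable {V : Type u} {T : SimpleGraph V}

lemma IsTree.path_eq {v w : V} (hT : T.IsTree) {p q : T.Walk v w} (hp : p.IsPath)
    (hq : q.IsPath) : p = q :=
  (hT.existsUnique_path v w).unique hp hq

/-- In a rooted tree, one of two adjacent vertices is the parent of the other. -/
lemma IsTree.path_cons_or {r v w : V} (hT : T.IsTree) (h : T.Adj v w) {p : T.Walk v r}
    {q : T.Walk w r} (hp : p.IsPath) (hq : q.IsPath) :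
    p = .cons h q ∨ q = .cons h.symm p := by
  classical
  by_cases hv : v ∈ q.support
  · right
    have h1 : q.takeUntil v hv = .cons h.symm .nil :=
      hT.path_eq (hq.takeUntil hv) (by simp [h.ne'])
    have h2 : q.dropUntil v hv = p := hT.path_eq (hq.dropUntil hv) hp
    rw [← q.take_spec hv, h1, h2]
    simp
  · left
    exact hT.path_eq hp (by simp [hq, hv])

/-- Two maps out of a connected graph which agree at a vertex agree everywhere, if they are lifts
of the same map through a locally injective map. -/
lemma Preconnected.lift_unique {W : Type*} {X : Type*} {T' : SimpleGraph W} (hT : T.Preconnected)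
    {p : W → X} (hp : ∀ w, Set.InjOn p (T'.neighborSet w)) {f g : V → W}
    (hf : ∀ u v, T.Adj u v → T'.Adj (f u) (f v)) (hg : ∀ u v, T.Adj u v → T'.Adj (g u) (g v))
    (hfg : ∀ v, p (f v) = p (g v)) {v₀ : V} (h₀ : f v₀ = g v₀) : f = g := by
  funext v
  obtain ⟨q⟩ := hT v₀ v
  induction q with
  | nil => exact h₀
  | cons h q ih =>
    refine ih (hp _ (hf _ _ h) ?_ (hfg _))
    rw [mem_neighborSet, h₀]
    exact hg _ _ h

/-- `σ` matches the neighbours of `v` bijectively with those of `y`, compatibly with the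
relation `C`. -/
structure IsLocalMatching {Y : Type*} (T : SimpleGraph V) (X : SimpleGraph Y) (C : V → Y → Prop)
    (v : V) (y : Y) (σ : V → Y) : Prop where
  bijOn : Set.BijOn σ (T.neighborSet v) (X.neighborSet y)
  compat : ∀ w, T.Adj v w → C w (σ w)

/-- A map out of a tree may be built outwards from a root: if, wherever `C v y` holds, the
neighbours of `v` can be matched with those of `y`, even with one pair of the matching prescribed,
then there is a locally bijective map with prescribed value at the root. -/
lemma IsTree.exists_locally_bijective {Y : Type*} {X : SimpleGraph Y} (hT : T.IsTree)
    (C : V → Y → Prop)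
    (hC : ∀ v y, C v y → ∃ σ, IsLocalMatching T X C v y σ)
    (hC' : ∀ v y u z, C v y → C u z → T.Adj v u → X.Adj y z →
      ∃ σ, IsLocalMatching T X C v y σ ∧ σ u = z)
    {v₀ : V} {y₀ : Y} (h₀ : C v₀ y₀) :
    ∃ f : V → Y, f v₀ = y₀ ∧ (∀ v, C v (f v)) ∧
      ∀ v, Set.BijOn f (T.neighborSet v) (X.neighborSet (f v)) := by
  -- The state at a vertex is its image together with a matching of the neighbours.
  let S : V → Type _ := fun v => {s : Y × (V → Y) // C v s.1 ∧ IsLocalMatching T X C v s.1 s.2}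
  have hstep : ∀ v w, T.Adj v w → ∀ s : S w, ∃ s' : S v, s'.1.1 = s.1.2 v ∧ s'.1.2 w = s.1.1 := by
    rintro v w h ⟨⟨y, τ⟩, hy, hτ⟩
    have hv : C v (τ v) := hτ.compat v h.symm
    have hadj : X.Adj y (τ v) := hτ.bijOn.mapsTo h.symm
    obtain ⟨σ, hσ, hw⟩ := hC' v (τ v) w y hv hy h hadj.symm
    exact ⟨⟨(τ v, σ), hv, hσ⟩, rfl, hw⟩
  choose step hstep1 hstep2 using hstep
  obtain ⟨σ₀, hσ₀⟩ := hC v₀ y₀ h₀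
  let state : ∀ {v r : V}, T.Walk v r → r = v₀ → S v := fun {v r} p =>
    Walk.rec (motive := fun v r _ => r = v₀ → S v)
      (fun {r} hr => ⟨(y₀, σ₀), hr ▸ h₀, hr ▸ hσ₀⟩)
      (fun {u v w} h _ ih hr => step u v h (ih hr)) p
  choose path hpath _ using fun v => hT.existsUnique_path v v₀
  let s : ∀ v, S v := fun v => state (path v) rfl
  have key : ∀ v w (h : T.Adj v w), path v = .cons h (path w) →
      (s v).1.1 = (s w).1.2 v ∧ (s v).1.2 w = (s w).1.1 := by
    intro v w h hvw
    have : s v = step v w h (s w) := by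
      change state (path v) rfl = _
      rw [hvw]
    rw [this]
    exact ⟨hstep1 _ _ _ _, hstep2 _ _ _ _⟩
  have hs : ∀ v w, T.Adj v w → (s w).1.1 = (s v).1.2 w := by
    intro v w h
    rcases hT.path_cons_or h (hpath v) (hpath w) with h' | h'
    · exact (key v w h h').2.symm
    · exact (key w v h.symm h').1
  refine ⟨fun v => (s v).1.1, ?_, fun v => (s v).2.1, fun v => ?_⟩
  · have : path v₀ = .nil := hT.path_eq (hpath v₀) .nil
    change (state (path v₀) rfl).1.1 = y₀
    rw [this]
  · exact (s v).2.2.bijOn.congr fun w hw => (hs v w hw).symm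

/-- A locally bijective map of graphs, that is, a covering. -/
def IsCover {Y : Type*} (T : SimpleGraph V) (X : SimpleGraph Y) (p : V → Y) : Prop :=
  ∀ v, Set.BijOn p (T.neighborSet v) (X.neighborSet (p v))

namespace IsCover

variable {W Y : Type*} {T' : SimpleGraph W} {X : SimpleGraph Y}

lemma adj {p : V → Y} (hp : T.IsCover X p) {u v : V} (h : T.Adj u v) : X.Adj (p u) (p v) :=
  (hp u).mapsTo h

/-- A covering of `X` by a tree factors through every other covering of `X`. -/
lemma exists_lift {p : W → Y} {q : V → Y} (hp : T'.IsCover X p) (hq : T.IsCover X q)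
    (hT : T.IsTree) {v₀ : V} {w₀ : W} (h₀ : q v₀ = p w₀) :
    ∃ f : V → W, f v₀ = w₀ ∧ (∀ v, p (f v) = q v) ∧ T.IsCover T' f := by
  have hC : ∀ v w, q v = p w → ∃ σ, IsLocalMatching T T' (fun v w => q v = p w) v w σ := by
    intro v w h
    have h1 := hq v
    rw [h] at h1
    have : Nonempty W := ⟨w⟩
    -- The only matching compatible with the relation is the lift of `q` through `p`.
    refine ⟨Function.invFunOn p (T'.neighborSet w) ∘ q,
      (hp w).invOn_invFunOn.symm.bijOn ?_ ?_ |>.comp h1, ?_⟩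
    · exact fun x hx => (hp w).surjOn hx |> Function.invFunOn_mem
    · exact (hp w).mapsTo
    · intro u hu
      exact (Function.invFunOn_eq ((hp w).surjOn (h1.mapsTo hu))).symm
  obtain ⟨f, hf, hf', hf''⟩ := hT.exists_locally_bijective (X := T') (fun v w => q v = p w) hC
    (by
      intro v w u z h h' huv hwz
      obtain ⟨σ, hσ⟩ := hC v w h
      refine ⟨σ, hσ, (hp w).injOn (hσ.bijOn.mapsTo huv) hwz ?_⟩
      rw [← hσ.compat u huv, h']) h₀
  exact ⟨f, hf, fun v => (hf' v).symm, hf''⟩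

/-- Two coverings of a graph by trees are isomorphic; the lifts in both directions are mutually
inverse by uniqueness of lifts. -/
lemma exists_iso {p : W → Y} {q : V → Y} (hp : T'.IsCover X p) (hq : T.IsCover X q)
    (hT : T.IsTree) (hT' : T'.IsTree) {v₀ : V} {w₀ : W} (h₀ : q v₀ = p w₀) :
    ∃ f : T ≃g T', f v₀ = w₀ ∧ ∀ v, p (f v) = q v := by
  obtain ⟨f, hf, hf', hf''⟩ := hp.exists_lift hq hT h₀
  obtain ⟨g, hg, hg', hg''⟩ := hq.exists_lift hp hT' h₀.symm
  have h1 : g ∘ f = id := hT.1.preconnected.lift_unique (fun v => (hq v).injOn)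
    (fun u v h => hg''.adj (hf''.adj h)) (fun _ _ h => h) (fun v => by simp [hg', hf'])
    (v₀ := v₀) (by simp [hf, hg])
  have h2 : f ∘ g = id := hT'.1.preconnected.lift_unique (fun v => (hp v).injOn)
    (fun u v h => hf''.adj (hg''.adj h)) (fun _ _ h => h) (fun v => by simp [hg', hf'])
    (v₀ := w₀) (by simp [hf, hg])
  refine ⟨⟨⟨f, g, congrFun h1, congrFun h2⟩, ?_⟩, hf, hf'⟩
  intro a b
  refine ⟨fun h => ?_, fun h => hf''.adj h⟩
  have e : ∀ x, g (f x) = x := congrFun h1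
  have := hg''.adj (show T'.Adj (f a) (f b) from h)
  rwa [e, e] at this

end IsCover

/-- A tree covers every graph with the same pattern of colours and degrees. -/
lemma IsTree.exists_isCover {Y : Type*} {X : SimpleGraph Y} (hT : T.IsTree) (d : Bool → ℕ)
    (c : T.Coloring Bool) (hc : ∀ v, (T.neighborSet v).encard = d (c v))
    (c' : X.Coloring Bool) (hc' : ∀ y, (X.neighborSet y).encard = d (c' y))
    {v₀ : V} {y₀ : Y} (h₀ : c v₀ = c' y₀) :
    ∃ p : V → Y, p v₀ = y₀ ∧ (∀ v, c v = c' (p v)) ∧ T.IsCover X p := by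
  classical
  have hflip : ∀ {v w y z}, c v = c' y → T.Adj v w → X.Adj y z → c w = c' z := by
    intro v w y z h hvw hyz
    have h1 := c.valid hvw
    have h2 := c'.valid hyz
    revert h h1 h2
    cases c v <;> cases c w <;> cases c' y <;> cases c' z <;> simp
  have hC : ∀ v y, c v = c' y → ∃ σ, IsLocalMatching T X (fun v y => c v = c' y) v y σ := by
    intro v y h
    have hfin : (T.neighborSet v).Finite := Set.finite_of_encard_eq_coe (hc v)
    have : Nonempty Y := ⟨y⟩
    obtain ⟨σ, hσ⟩ := hfin.exists_bijOn_of_encard_eq (t := X.neighborSet y)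
      (by rw [hc, hc', h])
    exact ⟨σ, hσ, fun w hw => hflip h hw (hσ.mapsTo hw)⟩
  refine hT.exists_locally_bijective _ hC ?_ h₀
  -- A transposition of the neighbours of `y` arranges that `u` is matched with `z`.
  intro v y u z h h' hvu hyz
  obtain ⟨σ, hσ⟩ := hC v y h
  have hbij : Set.BijOn (Equiv.swap (σ u) z ∘ σ) (T.neighborSet v) (X.neighborSet y) := by
    refine Set.BijOn.comp ?_ hσ.bijOn
    have hu : σ u ∈ X.neighborSet y := hσ.bijOn.mapsTo hvu
    have hz : z ∈ X.neighborSet y := hyz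
    have hm : Set.MapsTo (Equiv.swap (σ u) z) (X.neighborSet y) (X.neighborSet y) := by
      intro x hx
      rw [Equiv.swap_apply_def]
      split_ifs <;> assumption
    refine ⟨hm, (Equiv.injective _).injOn, fun x hx => ⟨_, hm hx, Equiv.swap_apply_self _ _ _⟩⟩
  exact ⟨_, ⟨hbij, fun w hw => hflip h hw (hbij.mapsTo hw)⟩, by simp⟩

end SimpleGraph

/-! ### Graphs of subgroups and their coset graphs -/

/-- A bipartite graph of groups all of whose groups are subgroups of an ambient group `A`, each
edge group being the intersection of the two adjacent vertex groups. The end `s` of every edge has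
colour `s`, and no two edges have the same ends, so that the edges of the coset graph correspond to
the cosets of the edge groups. -/
structure SubgroupGraph (A : Type) [Group A] where
  Vert : Type
  Edge : Type
  endpoint : Edge → Bool → Vert
  vertSubgroup : Vert → Subgroup A
  edgeSubgroup : Edge → Subgroup A
  edgeSubgroup_eq : ∀ e, edgeSubgroup e =
    vertSubgroup (endpoint e false) ⊓ vertSubgroup (endpoint e true)
  color : Vert → Bool
  color_endpoint : ∀ e s, color (endpoint e s) = s
  edge_ext : ∀ e e', (∀ s, endpoint e s = endpoint e' s) → e = e'

namespace SubgroupGraph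

variable {A : Type} [Group A] (D : SubgroupGraph A)

lemma edgeSubgroup_eq' (e : D.Edge) (s : Bool) : D.edgeSubgroup e =
    D.vertSubgroup (D.endpoint e (!s)) ⊓ D.vertSubgroup (D.endpoint e s) := by
  cases s
  · rw [D.edgeSubgroup_eq, inf_comm]; rfl
  · exact D.edgeSubgroup_eq e

lemma edgeSubgroup_le (e : D.Edge) (s : Bool) :
    D.edgeSubgroup e ≤ D.vertSubgroup (D.endpoint e s) := by
  rw [D.edgeSubgroup_eq' e s]
  exact inf_le_right

/-- The graph of groups whose monomorphisms are the inclusions. -/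
def toGraphOfGroups : GraphOfGroups where
  Vert := D.Vert
  Edge := D.Edge
  endpoint := D.endpoint
  vertGroup a := D.vertSubgroup a
  edgeGroup e := D.edgeSubgroup e
  mono e s := Subgroup.inclusion (D.edgeSubgroup_le e s)
  mono_injective e s := Subgroup.inclusion_injective (D.edgeSubgroup_le e s)

/-- The vertices of the coset graph: the cosets of the vertex groups. -/
abbrev CosetVert : Type := Σ a : D.Vert, A ⧸ D.vertSubgroup a

/-- The coset `g A_a` as a vertex of the coset graph. -/
def coset (a : D.Vert) (g : A) : D.CosetVert := ⟨a, (g : A ⧸ D.vertSubgroup a)⟩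

variable {D}

lemma smul_coset (a : D.Vert) (g h : A) : g • D.coset a h = D.coset a (g * h) := rfl

lemma coset_fst (a : D.Vert) (g : A) : (D.coset a g).1 = a := rfl

lemma exists_eq_coset (x : D.CosetVert) : ∃ g, x = D.coset x.1 g := by
  obtain ⟨a, q⟩ := x
  obtain ⟨g, rfl⟩ := QuotientGroup.mk_surjective q
  exact ⟨g, rfl⟩

lemma coset_eq_iff {a : D.Vert} {g h : A} :
    D.coset a g = D.coset a h ↔ g⁻¹ * h ∈ D.vertSubgroup a := by
  rw [← QuotientGroup.eq]
  exact ⟨fun e => eq_of_heq (Sigma.mk.inj e).2, fun e => by rw [coset, e]; rfl⟩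

lemma smul_coset_one_eq_iff {a : D.Vert} {g : A} :
    g • D.coset a 1 = D.coset a 1 ↔ g ∈ D.vertSubgroup a := by
  rw [smul_coset, eq_comm, coset_eq_iff]
  simp

variable (D)

/-- The coset graph: every edge `e` of `D` and every `g : A` give an edge joining the cosets of
`g` at the two ends of `e`. It is the quotient of the Bass–Serre tree of `D` by the kernel of the
natural map from the fundamental group of `D` to `A`. -/
def cosetGraph : SimpleGraph D.CosetVert where
  Adj x y := ∃ e s g, x = D.coset (D.endpoint e s) g ∧ y = D.coset (D.endpoint e (!s)) g
  symm := ⟨by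
    rintro x y ⟨e, s, g, rfl, rfl⟩
    exact ⟨e, !s, g, rfl, by rw [Bool.not_not]⟩⟩
  loopless := ⟨by
    rintro x ⟨e, s, g, rfl, h⟩
    have h1 := congrArg (fun y : D.CosetVert => D.color y.1) h
    simp only [coset_fst, D.color_endpoint] at h1
    cases s <;> cases h1⟩

/-- The colouring of the coset graph induced by that of `D`. -/
def cosetColoring : D.cosetGraph.Coloring Bool :=
  SimpleGraph.Coloring.mk (fun x => D.color x.1) (by
    rintro x y ⟨e, s, g, rfl, rfl⟩
    simp only [coset_fst, D.color_endpoint]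
    cases s <;> simp)

variable {D}

lemma cosetColoring_apply (x : D.CosetVert) : D.cosetColoring x = D.color x.1 := rfl

lemma adj_coset (e : D.Edge) (s : Bool) (g : A) :
    D.cosetGraph.Adj (D.coset (D.endpoint e s) g) (D.coset (D.endpoint e (!s)) g) :=
  ⟨e, s, g, rfl, rfl⟩

lemma adj_smul {x y : D.CosetVert} (g : A) (h : D.cosetGraph.Adj x y) :
    D.cosetGraph.Adj (g • x) (g • y) := by
  obtain ⟨e, s, k, rfl, rfl⟩ := h
  exact ⟨e, s, g * k, rfl, rfl⟩

lemma adj_smul_iff {x y : D.CosetVert} (g : A) :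
    D.cosetGraph.Adj (g • x) (g • y) ↔ D.cosetGraph.Adj x y :=
  ⟨fun h => by simpa using adj_smul g⁻¹ h, adj_smul g⟩

lemma isCover_smul (g : A) :
    D.cosetGraph.IsCover D.cosetGraph (g • · : D.CosetVert → D.CosetVert) := by
  intro x
  refine ⟨fun y hy => adj_smul g hy, (MulAction.injective g).injOn, fun y hy => ?_⟩
  exact ⟨g⁻¹ • y, (adj_smul_iff g).1 (by simpa using hy), by simp⟩

/-- The neighbours of the trivial coset at `a` are the orbits of `A_a` on trivial cosets. -/
lemma neighborSet_coset_one {a : D.Vert} (E : Finset D.Edge)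
    (hE : ∀ e, e ∈ E ↔ D.endpoint e (D.color a) = a) :
    D.cosetGraph.neighborSet (D.coset a 1) = ⋃ e ∈ E,
      MulAction.orbit (D.vertSubgroup a) (D.coset (D.endpoint e (!(D.color a))) 1) := by
  ext y
  simp only [Set.mem_iUnion, SimpleGraph.mem_neighborSet, exists_prop]
  constructor
  · rintro ⟨e, s, g, h1, rfl⟩
    obtain rfl : a = D.endpoint e s := congrArg Sigma.fst h1
    have hg := coset_eq_iff.1 h1
    rw [inv_one, one_mul] at hg
    refine ⟨e, (hE e).2 (by rw [D.color_endpoint]), ⟨g, hg⟩, ?_⟩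
    rw [D.color_endpoint]
    exact congrArg (D.coset _) (mul_one g)
  · rintro ⟨e, he, ⟨g, hg⟩, rfl⟩
    refine ⟨e, D.color a, g, ?_, ?_⟩
    · rw [(hE e).1 he, coset_eq_iff]
      simpa using hg
    · exact congrArg (D.coset _) (mul_one g)

/-- If `E` is the set of edges at `a`, then the coset vertices over `a` have degree
`∑ e ∈ E, [A_a : A_e]`. -/
lemma encard_neighborSet_coset [Finite A] {a : D.Vert} (E : Finset D.Edge)
    (hE : ∀ e, e ∈ E ↔ D.endpoint e (D.color a) = a) (g : A) :
    (D.cosetGraph.neighborSet (D.coset a g)).encard =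
      ((∑ e ∈ E, (D.edgeSubgroup e).relIndex (D.vertSubgroup a) : ℕ) : ℕ∞) := by
  classical
  have h1 : D.cosetGraph.neighborSet (D.coset a g) =
      (g • ·) '' D.cosetGraph.neighborSet (D.coset a 1) := by
    have := (isCover_smul (D := D) g (D.coset a 1)).image_eq
    rw [this]
    simp only [smul_coset, mul_one]
  rw [h1, (MulAction.injective g).encard_image, neighborSet_coset_one E hE]
  have hdisj : (E : Set D.Edge).PairwiseDisjoint fun e =>
      MulAction.orbit (D.vertSubgroup a) (D.coset (D.endpoint e (!(D.color a))) 1) := by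
    intro e he e' he' hne
    rw [Function.onFun, Set.disjoint_left]
    rintro _ ⟨⟨x, hx⟩, rfl⟩ ⟨⟨y, hy⟩, h⟩
    have h2 : D.endpoint e' (!(D.color a)) = D.endpoint e (!(D.color a)) := congrArg Sigma.fst h
    have h3 : D.endpoint e' (D.color a) = D.endpoint e (D.color a) := by
      rw [(hE e).1 he, (hE e').1 he']
    refine hne (D.edge_ext _ _ fun s => ?_)
    rcases Bool.eq_or_eq_not s (D.color a) with rfl | rfl
    · exact h3.symm
    · exact h2.symm
  have hcard : ∀ e ∈ E, (MulAction.orbit (D.vertSubgroup a)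
      (D.coset (D.endpoint e (!(D.color a))) 1)).encard =
      ((D.edgeSubgroup e).relIndex (D.vertSubgroup a) : ℕ∞) := by
    intro e he
    have hfin : (MulAction.orbit (D.vertSubgroup a)
      (D.coset (D.endpoint e (!(D.color a))) 1)).Finite := Set.finite_range _
    have h3 := MulAction.index_stabilizer (D.vertSubgroup a)
      (D.coset (D.endpoint e (!(D.color a))) 1)
    have h2 : MulAction.stabilizer (D.vertSubgroup a) (D.coset (D.endpoint e (!(D.color a))) 1) =
        (D.vertSubgroup (D.endpoint e (!(D.color a)))).subgroupOf (D.vertSubgroup a) := by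
      ext x
      rw [MulAction.mem_stabilizer_iff, Subgroup.mem_subgroupOf, ← smul_coset_one_eq_iff]
      rfl
    rw [h2] at h3
    rw [← hfin.cast_ncard_eq, D.edgeSubgroup_eq' e (D.color a), (hE e).1 he,
      Subgroup.inf_relIndex_right]
    exact congrArg Nat.cast h3.symm
  have := (E.finite_toSet.encard_biUnion hdisj).trans (finsum_mem_coe_finset _ _)
  simp only [Finset.mem_coe] at this
  rw [this, Finset.sum_congr rfl hcard, Nat.cast_sum]

end SubgroupGraph

/-! ### The group of lifts and its quotient graph of groups -/

/-- A homomorphism that maps a subgroup `S` bijectively to a subgroup `B` restricts to an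
isomorphism. -/
noncomputable def MonoidHom.restrictEquiv {G H : Type*} [Group G] [Group H] (φ : G →* H)
    (S : Subgroup G) (B : Subgroup H) (hmem : ∀ g ∈ S, φ g ∈ B)
    (hinj : ∀ g ∈ S, φ g = 1 → g = 1) (hsurj : ∀ b ∈ B, ∃ g ∈ S, φ g = b) : S ≃* B :=
  MulEquiv.ofBijective ((φ.comp S.subtype).codRestrict B fun g => hmem g g.2) (by
    constructor
    · rw [injective_iff_map_eq_one]
      exact fun g hg => Subtype.ext (hinj g g.2 (congrArg Subtype.val hg))
    · rintro ⟨b, hb⟩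
      obtain ⟨g, hg, rfl⟩ := hsurj b hb
      exact ⟨⟨g, hg⟩, rfl⟩)

namespace SimpleGraph

/-- The automorphisms of `T` which lift, through `p`, the action of an element of `A`. -/
def liftGroup {V : Type u} (T : SimpleGraph V) (A : Type*) {Y : Type*} [Group A] [MulAction A Y]
    (p : V → Y) : Subgroup (T ≃g T) where
  carrier := {γ | ∃ a : A, ∀ v, p (γ v) = a • p v}
  mul_mem' := by
    rintro γ δ ⟨a, ha⟩ ⟨b, hb⟩
    refine ⟨a * b, fun v => ?_⟩
    rw [mul_smul, ← hb, ← ha]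
    rfl
  one_mem' := ⟨1, fun v => (one_smul A _).symm⟩
  inv_mem' := by
    rintro γ ⟨a, ha⟩
    refine ⟨a⁻¹, fun v => ?_⟩
    rw [eq_inv_smul_iff, ← ha]
    exact congrArg p (γ.apply_symm_apply v)

end SimpleGraph

namespace SubgroupGraph

variable {A : Type} [Group A] {D : SubgroupGraph A} {V : Type u} {T : SimpleGraph V}
  {p : V → D.CosetVert}

/-- The action of `g` on the coset graph lifts to `T`, with any prescribed compatible value. -/
lemma exists_lift_smul (hT : T.IsTree) (hp : T.IsCover D.cosetGraph p) (g : A) {u v : V}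
    (huv : p v = g • p u) :
    ∃ γ : T.liftGroup A p, γ • u = v ∧ ∀ w, p (γ • w) = g • p w := by
  have hq : T.IsCover D.cosetGraph (fun w => g • p w) := fun w =>
    (isCover_smul g (p w)).comp (hp w)
  obtain ⟨f, hf, hf'⟩ := hp.exists_iso hq hT hT huv.symm
  exact ⟨⟨f, g, hf'⟩, hf, hf'⟩

/-- A covering of the coset graph by a tree meets every vertex type as soon as it meets one, if
`D` is connected. -/
lemma exists_coset_one_eq (hp : T.IsCover D.cosetGraph p) {a₀ : D.Vert} {v₀ : V}
    (h₀ : p v₀ = D.coset a₀ 1)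
    (hconn : ∀ P : D.Vert → Prop, P a₀ →
      (∀ e s, P (D.endpoint e s) → P (D.endpoint e (!s))) → ∀ a, P a) (a : D.Vert) :
    ∃ v, p v = D.coset a 1 := by
  refine hconn (fun a => ∃ v, p v = D.coset a 1) ⟨v₀, h₀⟩ ?_ a
  rintro e s ⟨v, hv⟩
  obtain ⟨w, -, hw⟩ := (hp v).surjOn (show D.coset (D.endpoint e (!s)) 1 ∈ _ by
    rw [hv]
    exact adj_coset e s 1)
  exact ⟨w, hw⟩

/-- If a tree covers the coset graph of `D`, then the lifts of the action of `A` form a group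
acting on the tree with quotient graph of groups `D`. -/
theorem isQuotientOf_liftGroup (hT : T.IsTree) (hp : T.IsCover D.cosetGraph p)
    (hsurj : ∀ a : D.Vert, ∃ v, p v = D.coset a 1)
    (hfaith : ∀ g : A, (∀ a, g ∈ D.vertSubgroup a) → g = 1) :
    D.toGraphOfGroups.IsQuotientOf T (T.liftGroup A p) := by
  set Γ := T.liftGroup A p
  choose vert hvert using hsurj
  -- The lift of an edge starts at the lift of its red end; its other end need not be the lift of
  -- its blue end, but differs from it by a deck transformation.
  have hedge : ∀ e, ∃ w, T.Adj (vert (D.endpoint e false)) w ∧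
      p w = D.coset (D.endpoint e true) 1 := by
    intro e
    obtain ⟨w, hw, hw'⟩ := (hp (vert (D.endpoint e false))).surjOn
      (show D.coset (D.endpoint e true) 1 ∈ _ by
        rw [hvert]
        exact adj_coset e false 1)
    exact ⟨w, hw, hw'⟩
  choose nbr hadj hnbr using hedge
  let edge : D.Edge → Bool → V := fun e s => if s then nbr e else vert (D.endpoint e false)
  have hpedge : ∀ e s, p (edge e s) = D.coset (D.endpoint e s) 1 := by
    rintro e (_ | _)
    exacts [hvert _, hnbr _]
  have hφ : ∀ γ : Γ, ∃ a : A, ∀ v, p (γ • v) = a • p v := fun γ => γ.2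
  choose φ₀ hφ₀ using hφ
  -- An element of `Γ` lifts a single element of `A`, as the vertex groups intersect trivially.
  have huniq : ∀ (γ : Γ) (g : A), (∀ v, p (γ • v) = g • p v) → φ₀ γ = g := by
    intro γ g h
    refine (inv_mul_eq_one.1 (hfaith _ fun a => ?_)).symm
    rw [← coset_eq_iff, ← mul_one g, ← mul_one (φ₀ γ), ← smul_coset, ← smul_coset, ← hvert,
      ← hφ₀, ← h]
  let φ : Γ →* A := MonoidHom.mk' φ₀ fun γ δ => huniq _ _ fun v => by
    rw [mul_smul, mul_smul, ← hφ₀, ← hφ₀]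
  have hφ : ∀ (γ : Γ) v, p (γ • v) = φ γ • p v := hφ₀
  -- An automorphism in `Γ` is determined by its image in `A` and its value at one vertex.
  have hcov : ∀ (γ δ : Γ) (v : V), φ γ = φ δ → γ • v = δ • v → γ = δ := by
    intro γ δ v h h'
    refine Subtype.ext (DFunLike.coe_injective ?_)
    exact hT.1.preconnected.lift_unique (fun v => (hp v).injOn)
      (fun _ _ h => (γ : T ≃g T).map_rel_iff.2 h) (fun _ _ h => (δ : T ≃g T).map_rel_iff.2 h)
      (fun w => (hφ γ w).trans (by rw [h]; exact (hφ δ w).symm)) h'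
  have hone : ∀ (γ : Γ) (v : V), φ γ = 1 → γ • v = v → γ = 1 := fun γ v h h' =>
    hcov γ 1 v (by rw [h, map_one]) (by rw [h', one_smul])
  -- An element fixing a lift of a trivial coset acts through the corresponding vertex group.
  have hstab : ∀ (γ : Γ) (v : V) (a : D.Vert), p v = D.coset a 1 → γ • v = v →
      φ γ ∈ D.vertSubgroup a := by
    intro γ v a hv h
    rw [← smul_coset_one_eq_iff, ← hv, ← hφ, h]
  have hlift : ∀ (g : A) (u v : V), p v = g • p u → ∃ γ : Γ, γ • u = v ∧ φ γ = g := by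
    intro g u v h
    obtain ⟨γ, h1, h2⟩ := exists_lift_smul hT hp g h
    exact ⟨γ, h1, huniq γ g h2⟩
  have hfix : ∀ (g : A) (v : V) (a : D.Vert), p v = D.coset a 1 → g ∈ D.vertSubgroup a →
      ∃ γ : Γ, γ • v = v ∧ φ γ = g := by
    intro g v a hv hg
    refine hlift g v v ?_
    rw [hv, smul_coset_one_eq_iff.2 hg]
  have hadj' : ∀ e, T.Adj (edge e false) (edge e true) := hadj
  have hsmuladj : ∀ (γ : Γ) {u v : V}, T.Adj u v → T.Adj (γ • u) (γ • v) :=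
    fun γ u v h => (γ : T ≃g T).map_rel_iff.2 h
  -- The elements carrying the lifted edges to the lifted vertices are chosen among the deck
  -- transformations, so that conjugation by them is invisible in `A`.
  have helt : ∀ e s, ∃ γ : Γ, γ • edge e s = vert (D.endpoint e s) ∧ φ γ = 1 := by
    intro e s
    refine hlift 1 _ _ ?_
    rw [hvert, hpedge, one_smul]
  choose elt helt helt' using helt
  have hstabE : ∀ (e : D.Edge), ∀ γ ∈ MulAction.stabilizer Γ (edge e false) ⊓
      MulAction.stabilizer Γ (edge e true), φ γ ∈ D.edgeSubgroup e := by
    intro e γ hγ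
    rw [D.edgeSubgroup_eq]
    exact ⟨hstab γ _ _ (hpedge e false) hγ.1, hstab γ _ _ (hpedge e true) hγ.2⟩
  have hfixE : ∀ (e : D.Edge), ∀ g ∈ D.edgeSubgroup e, ∃ γ ∈
      MulAction.stabilizer Γ (edge e false) ⊓ MulAction.stabilizer Γ (edge e true), φ γ = g := by
    intro e g hg
    rw [D.edgeSubgroup_eq] at hg
    obtain ⟨γ, hγ, hγ'⟩ := hfix g _ _ (hpedge e false) hg.1
    refine ⟨γ, ⟨hγ, ?_⟩, hγ'⟩
    refine (hp (edge e false)).injOn ?_ (hadj' e) ?_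
    · rw [SimpleGraph.mem_neighborSet]
      have := hsmuladj γ (hadj' e)
      rwa [hγ] at this
    · rw [hφ, hγ', hpedge]
      exact smul_coset_one_eq_iff.2 hg.2
  refine ⟨{
    no_inversion := ?_
    vert := vert
    edge := edge
    edge_adj := hadj'
    vert_unique := ?_
    edge_unique := ?_
    elt := elt
    elt_smul := helt
    vertEquiv := fun a => φ.restrictEquiv (MulAction.stabilizer Γ (vert a)) (D.vertSubgroup a)
      (fun γ hγ => hstab γ _ _ (hvert a) hγ) (fun γ hγ h => hone γ _ h hγ)
      (fun g hg => hfix g _ a (hvert a) hg)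
    edgeEquiv := fun e => φ.restrictEquiv
      (MulAction.stabilizer Γ (edge e false) ⊓ MulAction.stabilizer Γ (edge e true))
      (D.edgeSubgroup e) (hstabE e) (fun γ hγ h => hone γ _ h hγ.1) (hfixE e)
    mono_eq := ?_ }⟩
  · rintro γ u v huv ⟨h, -⟩
    have h1 := D.cosetColoring.valid (hp.adj huv)
    rw [← h, hφ] at h1
    exact h1 rfl
  · intro v
    obtain ⟨g, hg⟩ := exists_eq_coset (p v)
    refine ⟨(p v).1, ?_, ?_⟩
    · obtain ⟨γ, hγ, -⟩ := hlift g (vert (p v).1) v (by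
        rw [hvert, smul_coset, mul_one]; exact hg)
      exact ⟨γ, hγ⟩
    · rintro (a : D.Vert) ⟨γ, rfl⟩
      rw [hφ, hvert]
      rfl
  · -- Every edge is a translate of a chosen edge, which is determined by the types of its ends.
    have hex : ∀ u v : V, T.Adj u v → (∃ e, ∃ γ : Γ, (γ • edge e false = u ∧ γ • edge e true = v) ∨
        (γ • edge e false = v ∧ γ • edge e true = u)) := by
      intro u v huv
      obtain ⟨e, s, g, h1, h2⟩ := hp.adj huv
      have hl : ∀ s, ∀ u v, T.Adj u v → p u = D.coset (D.endpoint e s) g →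
          p v = D.coset (D.endpoint e (!s)) g →
          ∃ γ : Γ, γ • edge e s = u ∧ γ • edge e (!s) = v := by
        intro s u v huv h1 h2
        obtain ⟨γ, hγ, hγ'⟩ := hlift g (edge e s) u (by rw [hpedge, h1, smul_coset, mul_one])
        refine ⟨γ, hγ, (hp u).injOn ?_ huv ?_⟩
        · rw [SimpleGraph.mem_neighborSet, ← hγ]
          refine hsmuladj γ ?_
          cases s
          exacts [hadj' e, (hadj' e).symm]
        · rw [hφ, hγ', hpedge, h2, smul_coset, mul_one]
      obtain ⟨γ, hγ⟩ := hl s u v huv h1 h2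
      refine ⟨e, γ, ?_⟩
      cases s
      exacts [Or.inl hγ, Or.inr hγ.symm]
    intro u v huv
    obtain ⟨e, γ, h⟩ := hex u v huv
    refine ⟨e, ⟨γ, h⟩, ?_⟩
    have hfst : ∀ (e : D.Edge) (s : Bool) (γ : Γ) (u : V), γ • edge e s = u →
        (p u).1 = D.endpoint e s := by
      rintro e s γ u rfl
      rw [hφ, hpedge]
      rfl
    have hcol : ∀ (e : D.Edge) (s : Bool) (γ : Γ) (u : V), γ • edge e s = u →
        D.color (p u).1 = s := fun e s γ u h => by rw [hfst e s γ u h, D.color_endpoint]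
    have hsame : ∀ (e e' : D.Edge) (γ γ' : Γ) (u v : V),
        (γ • edge e false = u ∧ γ • edge e true = v) →
        (γ' • edge e' false = u ∧ γ' • edge e' true = v) → e' = e := by
      intro e e' γ γ' u v h h'
      refine D.edge_ext _ _ ?_
      rintro (_ | _)
      · rw [← hfst e' _ _ _ h'.1, hfst e _ _ _ h.1]
      · rw [← hfst e' _ _ _ h'.2, hfst e _ _ _ h.2]
    rintro e' ⟨γ', h'⟩
    rcases h with h | h <;> rcases h' with h' | h'
    · exact hsame _ _ _ _ _ _ h h'
    · exact absurd ((hcol _ _ _ _ h.1).symm.trans (hcol _ _ _ _ h'.2)) (by simp)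
    · exact absurd ((hcol _ _ _ _ h.1).symm.trans (hcol _ _ _ _ h'.2)) (by simp)
    · exact hsame _ _ _ _ _ _ h h'
  · intro (e : D.Edge) s x y hxy
    refine Subtype.ext ?_
    change φ (y : Γ) = φ (x : Γ)
    rw [hxy, map_mul, map_mul, map_inv, helt', one_mul, inv_one, mul_one]

/-- If the coset graph of `D` is `(n, m)`-biregular, then `D` is the quotient graph of groups of a
group of automorphisms of the `(n, m)`-biregular tree. -/
theorem exists_isQuotientOf [Finite A] {n m : ℕ} (hn : n ≠ 0) (hm : m ≠ 0)
    (hT : T.IsBiregularTree n m) (a₀ : D.Vert)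
    (hconn : ∀ P : D.Vert → Prop, P a₀ →
      (∀ e s, P (D.endpoint e s) → P (D.endpoint e (!s))) → ∀ a, P a)
    (hfaith : ∀ g : A, (∀ a, g ∈ D.vertSubgroup a) → g = 1)
    (hdeg : ∀ a, ∃ E : Finset D.Edge, (∀ e, e ∈ E ↔ D.endpoint e (D.color a) = a) ∧
      ∑ e ∈ E, (D.edgeSubgroup e).relIndex (D.vertSubgroup a) = if D.color a then n else m) :
    ∃ Γ : Subgroup (T ≃g T), D.toGraphOfGroups.IsQuotientOf T Γ := by
  choose E hE hdeg using hdeg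
  obtain ⟨c, hc⟩ := hT.biregular
  have hc' : ∀ v, (T.neighborSet v).encard = ((fun b : Bool => if b then n else m) (c v) : ℕ) := by
    intro v
    rw [hc v]
  obtain ⟨v₁⟩ := hT.isTree.1.nonempty
  -- Both colours occur in `T`, since every vertex has a neighbour.
  obtain ⟨v₀, hv₀⟩ : ∃ v, c v = D.cosetColoring (D.coset a₀ 1) := by
    obtain ⟨v₂, h⟩ : (T.neighborSet v₁).Nonempty := by
      rw [← Set.encard_ne_zero, hc']
      cases c v₁ <;> simpa
    have h1 := c.valid h
    by_cases h2 : c v₁ = D.cosetColoring (D.coset a₀ 1)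
    · exact ⟨v₁, h2⟩
    · refine ⟨v₂, ?_⟩
      revert h1 h2
      cases c v₁ <;> cases c v₂ <;> cases D.cosetColoring (D.coset a₀ 1) <;> simp
  obtain ⟨p, hp₀, -, hp⟩ := hT.isTree.exists_isCover (X := D.cosetGraph)
    (fun b : Bool => if b then n else m) c hc' D.cosetColoring (fun x => by
      obtain ⟨g, hg⟩ := exists_eq_coset x
      rw [cosetColoring_apply]
      generalize x.1 = a at hg
      subst hg
      rw [encard_neighborSet_coset (E a) (hE a), hdeg]) hv₀
  exact ⟨_, isQuotientOf_liftGroup hT.isTree hp (exists_coset_one_eq hp hp₀ hconn) hfaith⟩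

end SubgroupGraph

/-! ### Fundamental domains of discrete subgroups -/

/-- A discrete subgroup of a second countable group has a Borel fundamental domain for its action
by left translation. -/
lemma Subgroup.exists_isFundamentalDomain {G : Type*} [Group G] [TopologicalSpace G]
    [IsTopologicalGroup G] [SecondCountableTopology G] [MeasurableSpace G] [BorelSpace G]
    (Γ : Subgroup G) [DiscreteTopology Γ] (μ : Measure G) :
    ∃ F : Set G, IsFundamentalDomain Γ F μ := by
  -- The translates of `W g` by different elements of `Γ` are disjoint, for every `g`.
  obtain ⟨W, hW, hWΓ⟩ : ∃ W ∈ 𝓝 (1 : G), IsOpen W ∧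
      ∀ x ∈ W, ∀ y ∈ W, x * y⁻¹ ∈ Γ → x * y⁻¹ = 1 := by
    obtain ⟨U, hU, hUΓ⟩ := isOpen_induced_iff.1 (isOpen_discrete ({1} : Set Γ))
    have h1 : (1 : Γ) ∈ Subtype.val ⁻¹' U := by rw [hUΓ]; rfl
    have h2 : ContinuousAt (fun z : G × G => z.1 * z.2⁻¹) (1, 1) :=
      (continuous_fst.mul continuous_snd.inv).continuousAt
    have h3 := h2.preimage_mem_nhds (hU.mem_nhds (by simpa using h1))
    rw [nhds_prod_eq, mem_prod_same_iff] at h3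
    obtain ⟨W, hW, hW'⟩ := h3
    refine ⟨interior W, interior_mem_nhds.2 hW, isOpen_interior, fun x hx y hy h => ?_⟩
    have h4 : x * y⁻¹ ∈ U := hW' (Set.mk_mem_prod (interior_subset hx) (interior_subset hy))
    have h5 : (⟨x * y⁻¹, h⟩ : Γ) ∈ Subtype.val ⁻¹' U := h4
    rw [hUΓ] at h5
    exact congrArg Subtype.val h5
  obtain ⟨hWo, hWΓ⟩ := hWΓ
  obtain ⟨s, hs, hs'⟩ := TopologicalSpace.countable_cover_nhds
    (f := fun g : G => (· * g⁻¹) ⁻¹' W) (fun g =>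
      (continuous_mul_const g⁻¹).continuousAt.preimage_mem_nhds (by simpa using hW))
  have hsne : s.Nonempty := by
    have : (1 : G) ∈ ⋃ g ∈ s, (· * g⁻¹) ⁻¹' W := hs' ▸ Set.mem_univ _
    simp only [Set.mem_iUnion] at this
    obtain ⟨g, hg, -⟩ := this
    exact ⟨g, hg⟩
  obtain ⟨g, rfl⟩ := hs.exists_eq_range hsne
  let U : ℕ → Set G := fun i => (· * (g i)⁻¹) ⁻¹' W
  have hUo : ∀ i, IsOpen (U i) := fun i => hWo.preimage (continuous_mul_const _)
  -- `S i` is the union of the `Γ`-translates of `U i`.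
  let S : ℕ → Set G := fun i => ⋃ γ : Γ, (fun x : G => (γ : G) * x) ⁻¹' U i
  have hSo : ∀ i, IsOpen (S i) := fun i =>
    isOpen_iUnion fun γ => (hUo i).preimage (continuous_const_mul _)
  have hSmem : ∀ i x, x ∈ S i ↔ ∃ γ : Γ, (γ : G) * x ∈ U i := fun i x => Set.mem_iUnion
  have hSsmul : ∀ i x (γ : Γ), (γ : G) * x ∈ S i ↔ x ∈ S i := by
    intro i x γ
    rw [hSmem, hSmem]
    constructor
    · rintro ⟨δ, hδ⟩
      exact ⟨δ * γ, by rwa [Subgroup.coe_mul, mul_assoc]⟩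
    · rintro ⟨δ, hδ⟩
      exact ⟨δ * γ⁻¹, by simpa using hδ⟩
  -- A point lies in the domain if it lies in `U i` for the first `i` such that `U i` meets its orbit.
  refine ⟨⋃ i, U i \ ⋃ j < i, S j, .mk' (MeasurableSet.nullMeasurableSet ?_) fun x => ?_⟩
  · refine MeasurableSet.iUnion fun i => (hUo i).measurableSet.diff ?_
    exact MeasurableSet.iUnion fun j => MeasurableSet.iUnion fun _ => (hSo j).measurableSet
  · have hx : ∃ i, x ∈ S i := by
      have : x ∈ ⋃ y ∈ Set.range g, (· * y⁻¹) ⁻¹' W := hs' ▸ Set.mem_univ _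
      simp only [Set.mem_iUnion, Set.mem_range] at this
      obtain ⟨_, ⟨i, rfl⟩, h⟩ := this
      exact ⟨i, (hSmem i x).2 ⟨1, by simpa [U] using h⟩⟩
    classical
    have hmem : ∀ γ : Γ, γ • x ∈ (⋃ i, U i \ ⋃ j < i, S j) ↔ (γ : G) * x ∈ U (Nat.find hx) := by
      intro γ
      simp only [Set.mem_iUnion, Set.mem_sdiff, not_exists]
      constructor
      · rintro ⟨i, hi, hj⟩
        have : Nat.find hx = i := by
          refine (Nat.find_eq_iff hx).2 ⟨(hSmem i x).2 ⟨γ, hi⟩, fun j hji h => ?_⟩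
          exact hj j hji ((hSsmul j x γ).2 h)
        rw [this]
        exact hi
      · intro h
        exact ⟨_, h, fun j hj h' => Nat.find_min hx hj ((hSsmul j x γ).1 h')⟩
    obtain ⟨γ, hγ⟩ := (hSmem _ x).1 (Nat.find_spec hx)
    refine ⟨γ, (hmem γ).2 hγ, fun δ hδ => ?_⟩
    have hδ := (hmem δ).1 hδ
    have h1 : (δ : G) * x * (g (Nat.find hx))⁻¹ * ((γ : G) * x * (g (Nat.find hx))⁻¹)⁻¹ =
        ((δ * γ⁻¹ : Γ) : G) := by
      simp only [Subgroup.coe_mul, Subgroup.coe_inv]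
      group
    have h2 := hWΓ _ hδ _ hγ (by rw [h1]; exact SetLike.coe_mem _)
    rw [h1] at h2
    exact mul_inv_eq_one.1 (Subtype.ext h2)

/-! ### The topology of the automorphism group -/

namespace SimpleGraph

variable {V : Type u} {T : SimpleGraph V}

lemma isOpen_setOf_aut_apply_eq (x y : V) : IsOpen {g : T ≃g T | g x = y} := by
  let : TopologicalSpace V := ⊥
  have : DiscreteTopology V := ⟨rfl⟩
  exact isOpen_induced (f := fun g : T ≃g T => (g : V → V))
    ((isOpen_discrete ({y} : Set V)).preimage (continuous_apply x))

lemma continuous_aut_iff {Z : Type*} [TopologicalSpace Z] {f : Z → (T ≃g T)} :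
    Continuous f ↔ ∀ x y, IsOpen {z | f z x = y} := by
  refine ⟨fun h x y => (isOpen_setOf_aut_apply_eq x y).preimage h, fun h => ?_⟩
  let : TopologicalSpace V := ⊥
  have : DiscreteTopology V := ⟨rfl⟩
  refine continuous_induced_rng.2 (continuous_pi fun x => ?_)
  exact continuous_discrete_rng.2 fun y => h x y

instance : IsTopologicalGroup (T ≃g T) where
  continuous_mul := by
    refine continuous_aut_iff.2 fun x y => ?_
    have : {z : (T ≃g T) × (T ≃g T) | (z.1 * z.2) x = y} =
        ⋃ w, {g : T ≃g T | g w = y} ×ˢ {g : T ≃g T | g x = w} := by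
      ext z
      simp [RelIso.mul_apply]
    rw [this]
    exact isOpen_iUnion fun w =>
      (isOpen_setOf_aut_apply_eq w y).prod (isOpen_setOf_aut_apply_eq x w)
  continuous_inv := by
    refine continuous_aut_iff.2 fun x y => ?_
    have : {g : T ≃g T | g⁻¹ x = y} = {g : T ≃g T | g y = x} := by
      ext g
      exact ⟨fun h => h ▸ g.apply_symm_apply x, fun h => h ▸ g.symm_apply_apply y⟩
    rw [this]
    exact isOpen_setOf_aut_apply_eq y x

instance : T2Space (T ≃g T) := by
  let : TopologicalSpace V := ⊥
  have : DiscreteTopology V := ⟨rfl⟩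
  exact T2Space.of_injective_continuous (f := fun g : T ≃g T => (g : V → V))
    DFunLike.coe_injective continuous_induced_dom

lemma secondCountableTopology_aut [Countable V] : SecondCountableTopology (T ≃g T) := by
  let : TopologicalSpace V := ⊥
  have : DiscreteTopology V := ⟨rfl⟩
  exact TopologicalSpace.secondCountableTopology_induced _ _ (fun g : T ≃g T => (g : V → V))

lemma isOpen_stabilizer_aut (v : V) :
    IsOpen (MulAction.stabilizer (T ≃g T) v : Set (T ≃g T)) :=
  isOpen_setOf_aut_apply_eq v v

/-- The ball of radius `k` around `v`. -/
def walkBall (T : SimpleGraph V) (v : V) : ℕ → Set V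
  | 0 => {v}
  | k + 1 => ⋃ u ∈ T.walkBall v k, insert u (T.neighborSet u)

lemma finite_walkBall (hT : ∀ v, (T.neighborSet v).Finite) (v : V) (k : ℕ) :
    (T.walkBall v k).Finite := by
  induction k with
  | zero => exact Set.finite_singleton v
  | succ k ih => exact ih.biUnion fun u _ => (hT u).insert u

lemma Preconnected.exists_mem_walkBall (hT : T.Preconnected) (v x : V) :
    ∃ k, x ∈ T.walkBall v k := by
  obtain ⟨p⟩ := hT x v
  induction p with
  | nil => exact ⟨0, rfl⟩
  | cons h p ih =>
    obtain ⟨k, hk⟩ := ih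
    exact ⟨k + 1, Set.mem_biUnion hk (Set.mem_insert_of_mem _ h.symm)⟩

lemma Preconnected.countable (hT : T.Preconnected) (hT' : ∀ v, (T.neighborSet v).Finite) :
    Countable V := by
  rcases isEmpty_or_nonempty V with h | ⟨⟨v⟩⟩
  · infer_instance
  · refine Set.countable_univ_iff.1
      ((Set.countable_iUnion fun k => (finite_walkBall hT' v k).countable).mono fun x _ => ?_)
    exact Set.mem_iUnion.2 (hT.exists_mem_walkBall v x)

lemma aut_apply_mem_walkBall {v : V} {g : T ≃g T} (hg : g v = v) {k : ℕ} {x : V}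
    (hx : x ∈ T.walkBall v k) : g x ∈ T.walkBall v k := by
  induction k generalizing x with
  | zero =>
    obtain rfl : x = v := hx
    exact hg
  | succ k ih =>
    simp only [walkBall, Set.mem_iUnion, exists_prop] at hx ⊢
    obtain ⟨u, hu, hx⟩ := hx
    refine ⟨g u, ih hu, ?_⟩
    rcases hx with rfl | hx
    · exact Set.mem_insert _ _
    · exact Set.mem_insert_of_mem _ (g.map_rel_iff.2 hx)

/-- Vertex stabilisers are compact: `g ↦ (g, g⁻¹)` identifies them with closed subsets of a
product of finite sets. -/
lemma isCompact_stabilizer_aut (hT : T.Preconnected) (hT' : ∀ v, (T.neighborSet v).Finite)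
    (v : V) : IsCompact (MulAction.stabilizer (T ≃g T) v : Set (T ≃g T)) := by
  let : TopologicalSpace V := ⊥
  have : DiscreteTopology V := ⟨rfl⟩
  let Φ : (T ≃g T) → (V → V) × (V → V) := fun g => (g, (g⁻¹ : T ≃g T))
  have hcoe : Continuous fun g : T ≃g T => (g : V → V) := continuous_induced_dom
  have hΦ : Topology.IsInducing Φ := by
    refine Topology.IsInducing.of_comp (g := Prod.fst) ?_ continuous_fst ⟨rfl⟩
    exact hcoe.prodMk (hcoe.comp continuous_inv)
  rw [hΦ.isCompact_iff]
  choose k hk using hT.exists_mem_walkBall v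
  let K : Set (V → V) := Set.univ.pi fun x => T.walkBall v (k x)
  have hK : IsCompact K := isCompact_univ_pi fun x => (finite_walkBall hT' v (k x)).isCompact
  have himage : Φ '' (MulAction.stabilizer (T ≃g T) v : Set (T ≃g T)) = (K ×ˢ K) ∩
      ({z | z.1 v = v} ∩ ((⋂ x, ⋂ y, {z | z.1 x = y ↔ z.2 y = x}) ∩
        ⋂ x, ⋂ y, {z | T.Adj (z.1 x) (z.1 y) ↔ T.Adj x y})) := by
    ext z
    simp only [Set.mem_inter_iff, Set.mem_iInter, Set.mem_image]
    constructor
    · rintro ⟨g, hg, rfl⟩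
      refine ⟨⟨fun x _ => aut_apply_mem_walkBall hg (hk x), fun x _ =>
        aut_apply_mem_walkBall (g := g⁻¹) (inv_mem hg) (hk x)⟩, hg, fun x y => ?_,
        fun x y => g.map_rel_iff⟩
      exact ⟨fun h => h ▸ g.symm_apply_apply x, fun h => h ▸ g.apply_symm_apply y⟩
    · rintro ⟨-, hv, h1, h2⟩
      obtain ⟨f, h⟩ := z
      refine ⟨⟨⟨f, h, fun x => (h1 x _).1 rfl, fun y => (h1 _ y).2 rfl⟩, fun {x y} => h2 x y⟩,
        hv, rfl⟩
  rw [himage]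
  have hdisc : ∀ x y (P : V → V → Prop),
      IsClosed {z : (V → V) × (V → V) | P (z.1 x) (z.2 y)} := by
    intro x y P
    have hc : Continuous fun z : (V → V) × (V → V) => (z.1 x, z.2 y) := by fun_prop
    exact (isClosed_discrete {w : V × V | P w.1 w.2}).preimage hc
  have hdisc' : ∀ x y (P : V → V → Prop),
      IsClosed {z : (V → V) × (V → V) | P (z.1 x) (z.1 y)} := by
    intro x y P
    have hc : Continuous fun z : (V → V) × (V → V) => (z.1 x, z.1 y) := by fun_prop
    exact (isClosed_discrete {w : V × V | P w.1 w.2}).preimage hc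
  refine (hK.prod hK).inter_right (.inter (hdisc' v v fun a _ => a = v) (.inter ?_ ?_))
  · exact isClosed_iInter fun x => isClosed_iInter fun y => hdisc x y fun a b => a = y ↔ b = x
  · exact isClosed_iInter fun x => isClosed_iInter fun y =>
      hdisc' x y fun a b => T.Adj a b ↔ T.Adj x y

end SimpleGraph

open scoped ENNReal

/-! ### The covolume as a sum over vertex groups -/

lemma tsum_ite_smul_eq {Γ V : Type*} [Group Γ] [MulAction Γ V] (v w : V) (h : ∃ γ : Γ, γ • v = w)
    [DecidableEq V] [Finite (MulAction.stabilizer Γ v)] :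
    ∑' γ : Γ, (if γ • v = w then 1 else 0 : ℝ≥0∞) = Nat.card (MulAction.stabilizer Γ v) := by
  obtain ⟨δ, rfl⟩ := h
  rw [← (Equiv.mulLeft δ).tsum_eq]
  have h1 : ∀ γ : Γ, (if Equiv.mulLeft δ γ • v = δ • v then 1 else 0 : ℝ≥0∞) =
      Set.indicator (MulAction.stabilizer Γ v : Set Γ) (fun _ => 1) γ := by
    intro γ
    by_cases h : γ • v = v <;> simp [Set.indicator, h, mul_smul]
  simp_rw [h1]
  rw [← tsum_subtype, ENNReal.tsum_set_one]
  have hfin : (MulAction.stabilizer Γ v : Set Γ).Finite := Set.toFinite _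
  rw [← hfin.cast_ncard_eq]
  rfl

/-- Summing over a family of orbit representatives, weighted by the orders of the stabilisers,
sums up a function on `V` over all orbits. -/
lemma tsum_orbit_representatives {Γ V ι : Type*} [Group Γ] [MulAction Γ V] (r : ι → V)
    (hr : ∀ v, ∃! a, ∃ γ : Γ, γ • r a = v) [∀ a, Finite (MulAction.stabilizer Γ (r a))]
    (f : V → ℝ≥0∞) :
    ∑' a, (Nat.card (MulAction.stabilizer Γ (r a)) : ℝ≥0∞)⁻¹ * ∑' γ : Γ, f (γ • r a) =
      ∑' v, f v := by
  classical
  have h1 : ∀ a, ∑' γ : Γ, f (γ • r a) =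
      ∑' v, f v * ∑' γ : Γ, (if γ • r a = v then 1 else 0 : ℝ≥0∞) := by
    intro a
    simp_rw [← ENNReal.tsum_mul_left]
    rw [ENNReal.tsum_comm]
    refine tsum_congr fun γ => ?_
    rw [tsum_eq_single (γ • r a)]
    · simp
    · intro v hv
      simp [hv.symm]
  have h2 : ∀ a, (Nat.card (MulAction.stabilizer Γ (r a)) : ℝ≥0∞)⁻¹ * ∑' γ : Γ, f (γ • r a) =
      ∑' v, (Nat.card (MulAction.stabilizer Γ (r a)) : ℝ≥0∞)⁻¹ *
        (f v * ∑' γ : Γ, (if γ • r a = v then 1 else 0 : ℝ≥0∞)) := fun a => by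
    rw [h1, ENNReal.tsum_mul_left]
  rw [tsum_congr h2, ENNReal.tsum_comm]
  refine tsum_congr fun v => ?_
  obtain ⟨a, ha, ha'⟩ := hr v
  rw [tsum_eq_single a]
  · rw [tsum_ite_smul_eq _ _ ha, mul_left_comm, ENNReal.inv_mul_cancel, mul_one]
    · exact_mod_cast Nat.card_pos.ne'
    · exact ENNReal.natCast_ne_top _
  · intro b hb
    have : ∀ γ : Γ, γ • r b ≠ v := fun γ hγ => hb (ha' b ⟨γ, hγ⟩)
    simp [this]

/-- The measure of a fundamental domain `F` of `Γ` in terms of the stabilisers in `Γ` of points of a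
countable `G`-set `V`. The mass of `F` is spread over `V` by sending `g` to its values at
representatives of the `G`-orbits. -/
lemma MeasureTheory.IsFundamentalDomain.measure_eq_tsum_inv_card {G V ι : Type*} [Group G]
    [MeasurableSpace G] [MeasurableMul G] [MulAction G V] [Countable V] {Γ : Subgroup G}
    [Countable Γ] {μ : Measure G} [μ.IsMulLeftInvariant] {F : Set G}
    (hF : IsFundamentalDomain Γ F μ)
    (hmeas : ∀ v w : V, MeasurableSet {g : G | g • v = w})
    (hzero : ∀ v : V, μ (MulAction.stabilizer G v : Set G) ≠ 0)
    (htop : ∀ v : V, μ (MulAction.stabilizer G v : Set G) ≠ ∞)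
    (hnorm : ∑' o : MulAction.orbitRel.Quotient G V,
      (μ (MulAction.stabilizer G o.out : Set G))⁻¹ = 1)
    (r : ι → V) (hr : ∀ v, ∃! a, ∃ γ : Γ, γ • r a = v)
    [∀ a, Finite (MulAction.stabilizer Γ (r a))] :
    μ F = ∑' a, (Nat.card (MulAction.stabilizer Γ (r a)) : ℝ≥0∞)⁻¹ := by
  let f : V → ℝ≥0∞ := fun w => ∑' o : MulAction.orbitRel.Quotient G V,
    (μ (MulAction.stabilizer G o.out : Set G))⁻¹ * μ ({g | g • o.out = w} ∩ F)
  -- `f w` is the mass carried to `w` by the elements of `F`.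
  have hsum : ∑' w, f w = μ F := by
    have h0 : ∑' w, f w = ∑' o : MulAction.orbitRel.Quotient G V, ∑' w,
      (μ (MulAction.stabilizer G o.out : Set G))⁻¹ * μ ({g | g • o.out = w} ∩ F) :=
      ENNReal.tsum_comm
    have h1 : ∀ o : MulAction.orbitRel.Quotient G V,
        ∑' w, μ ({g | g • o.out = w} ∩ F) = μ F := by
      intro o
      have := measure_iUnion₀ (μ := μ.restrict F) (f := fun w : V => {g : G | g • o.out = w})
        (fun v w hvw => Disjoint.aedisjoint (Set.disjoint_left.2 fun g hg hg' =>
          hvw (hg.symm.trans hg'))) (fun w => (hmeas _ w).nullMeasurableSet)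
      rw [tsum_congr fun w => (Measure.restrict_apply (hmeas o.out w)).symm, ← this,
        show (⋃ w : V, {g : G | g • o.out = w}) = Set.univ from Set.ext fun g => by simp,
        Measure.restrict_apply_univ]
    simp_rw [h0, ENNReal.tsum_mul_left, h1, ENNReal.tsum_mul_right, hnorm, one_mul]
  -- Only the `G`-orbit of `w` contributes, and the translates of `F` exhaust the coset of elements
  -- carrying its representative to `w`, which has the measure of the stabiliser.
  have hone : ∀ w, ∑' γ : Γ, f (γ • w) = 1 := by
    intro w
    have h0 : ∑' γ : Γ, f (γ • w) = ∑' o : MulAction.orbitRel.Quotient G V, ∑' γ : Γ,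
      (μ (MulAction.stabilizer G o.out : Set G))⁻¹ * μ ({g | g • o.out = γ • w} ∩ F) :=
      ENNReal.tsum_comm
    have h1 : ∀ o : MulAction.orbitRel.Quotient G V,
        ∑' γ : Γ, μ ({g | g • o.out = γ • w} ∩ F) = μ {g | g • o.out = w} := by
      intro o
      rw [hF.measure_eq_tsum]
      refine tsum_congr fun γ => ?_
      congr 2
      ext g
      rw [Set.mem_smul_set_iff_inv_smul_mem]
      change g • o.out = γ • w ↔ (γ⁻¹ • g) • o.out = w
      rw [smul_assoc, inv_smul_eq_iff]
    simp_rw [h0, ENNReal.tsum_mul_left, h1]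
    have h2 : ∃ g : G, g • (Quotient.mk (MulAction.orbitRel G V) w).out = w := by
      have := Quotient.exact (s := MulAction.orbitRel G V)
        (Quotient.out_eq (Quotient.mk (MulAction.orbitRel G V) w)).symm
      exact this
    rw [tsum_eq_single (Quotient.mk (MulAction.orbitRel G V) w)]
    · obtain ⟨g, hg⟩ := h2
      set o := Quotient.mk (MulAction.orbitRel G V) w
      have h3 : {x : G | x • o.out = w} = (fun x => g⁻¹ * x) ⁻¹'
          (MulAction.stabilizer G o.out : Set G) := by
        ext x
        rw [Set.mem_preimage, SetLike.mem_coe, MulAction.mem_stabilizer_iff, mul_smul,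
          inv_smul_eq_iff, hg]
        rfl
      rw [h3, measure_preimage_mul, ENNReal.inv_mul_cancel (hzero _) (htop _)]
    · intro o ho
      have : {g : G | g • o.out = w} = ∅ := by
        refine Set.eq_empty_of_forall_notMem fun g hg => ho ?_
        rw [← Quotient.out_eq o]
        refine Quotient.sound ?_
        change o.out ∈ MulAction.orbit G w
        rw [← (show g • o.out = w from hg), MulAction.orbit_smul]
        exact MulAction.mem_orbit_self _
      rw [this, measure_empty, mul_zero]
  rw [← hsum, ← tsum_orbit_representatives r hr]
  simp_rw [hone, mul_one]

namespace GraphOfGroups.QuotientPresentation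

variable {V : Type u} {T : SimpleGraph V} {Γ : Subgroup (T ≃g T)} {𝒢 : GraphOfGroups}

lemma finite_stabilizer (P : 𝒢.QuotientPresentation T Γ) [∀ a, Finite (𝒢.vertGroup a)]
    (a : 𝒢.Vert) : Finite (MulAction.stabilizer Γ (P.vert a)) :=
  Finite.of_equiv _ (P.vertEquiv a).symm.toEquiv

/-- Finite vertex groups make `Γ` discrete, since vertex stabilisers are open. -/
lemma discreteTopology (P : 𝒢.QuotientPresentation T Γ) [Nonempty V]
    [∀ a, Finite (𝒢.vertGroup a)] : DiscreteTopology Γ := by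
  obtain ⟨a, -⟩ := (P.vert_unique (Classical.arbitrary V)).exists
  have hfin := P.finite_stabilizer a
  have hopen : IsOpen (MulAction.stabilizer Γ (P.vert a) : Set Γ) :=
    (SimpleGraph.isOpen_stabilizer_aut (P.vert a)).preimage continuous_subtype_val
  have hfin' : (MulAction.stabilizer Γ (P.vert a) \ {1} : Set Γ).Finite := Set.toFinite _
  refine discreteTopology_of_isOpen_singleton_one ?_
  convert! hopen.sdiff hfin'.isClosed using 1
  ext γ
  simp only [Set.mem_singleton_iff, Set.mem_sdiff, not_and, not_not]
  exact ⟨fun h => ⟨h ▸ one_mem _, fun _ => h⟩, fun h => h.2 h.1⟩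

/-- A group with finite quotient graph and finite vertex groups is a uniform lattice. -/
theorem isUniformLattice (P : 𝒢.QuotientPresentation T Γ) (hT : T.Connected)
    (hT' : ∀ v, (T.neighborSet v).Finite) [Finite 𝒢.Vert] [∀ a, Finite (𝒢.vertGroup a)] :
    IsUniformLattice Γ := by
  have := hT.nonempty
  refine ⟨P.discreteTopology, ?_⟩
  obtain ⟨v⟩ := hT.nonempty
  -- `G` is the union of the sets `Γ (g a) G_v`, with `g a` carrying `v` to the lift of `a`.
  have hg : ∀ a, ∃ g : T ≃g T, (∃ h : T ≃g T, h • v = P.vert a) → g • v = P.vert a := by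
    intro a
    by_cases h : ∃ h : T ≃g T, h • v = P.vert a
    exacts [⟨h.choose, fun _ => h.choose_spec⟩, ⟨1, fun h' => absurd h' h⟩]
  choose g hg using hg
  let K : Set (T ≃g T) := ⋃ a, (g a * ·) '' (MulAction.stabilizer (T ≃g T) v : Set (T ≃g T))
  have hK : IsCompact K := isCompact_iUnion fun a =>
    (SimpleGraph.isCompact_stabilizer_aut hT.preconnected hT' v).image (continuous_const_mul _)
  have hcont : Continuous (Quotient.mk (QuotientGroup.rightRel Γ)) := continuous_quotient_mk'
  refine ⟨?_⟩
  convert! hK.image hcont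
  refine (Set.eq_univ_of_forall fun q => ?_).symm
  induction q using Quotient.inductionOn with
  | h x =>
    obtain ⟨a, γ, hγ⟩ := (P.vert_unique (x • v)).exists
    have h1 : ((γ : T ≃g T)⁻¹ * x) • v = P.vert a := by
      rw [mul_smul, inv_smul_eq_iff]
      exact hγ.symm
    refine ⟨(γ : T ≃g T)⁻¹ * x, ?_, ?_⟩
    · refine Set.mem_iUnion.2 ⟨a, (g a)⁻¹ * ((γ : T ≃g T)⁻¹ * x), ?_, mul_inv_cancel_left _ _⟩
      rw [SetLike.mem_coe, MulAction.mem_stabilizer_iff, mul_smul, h1, inv_smul_eq_iff,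
        hg a ⟨_, h1⟩]
    · refine Quotient.sound ?_
      rw [← Quotient.eq_iff_equiv, Quotient.eq, QuotientGroup.rightRel_apply]
      simp

lemma finite_orbits (P : 𝒢.QuotientPresentation T Γ) [Finite 𝒢.Vert] :
    Finite (MulAction.orbitRel.Quotient (T ≃g T) V) := by
  refine Finite.of_surjective (fun a => Quotient.mk _ (P.vert a)) fun o => ?_
  induction o using Quotient.inductionOn with
  | h v =>
    obtain ⟨a, γ, hγ⟩ := (P.vert_unique v).exists
    refine ⟨a, Quotient.sound ⟨(γ : T ≃g T)⁻¹, ?_⟩⟩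
    exact inv_smul_eq_iff.2 hγ.symm

end GraphOfGroups.QuotientPresentation

namespace SimpleGraph

variable {V : Type u} {T : SimpleGraph V}

/-- The covolume of a group acting on `T` is the sum of the reciprocals of the orders of the vertex
groups of its quotient graph of groups. -/
theorem IsSerreHaar.covolume_eq {Γ : Subgroup (T ≃g T)} {𝒢 : GraphOfGroups}
    {μ : Measure (T ≃g T)} (hμ : T.IsSerreHaar μ) (P : 𝒢.QuotientPresentation T Γ)
    (hT : T.Connected) (hT' : ∀ v, (T.neighborSet v).Finite) [∀ a, Finite (𝒢.vertGroup a)] :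
    covolume Γ (T ≃g T) μ = ∑' a, (Nat.card (𝒢.vertGroup a) : ℝ≥0∞)⁻¹ := by
  have := hμ.isHaar
  have := hT.nonempty
  have := hT.preconnected.countable hT'
  have := secondCountableTopology_aut (T := T)
  have := P.discreteTopology
  have : Countable Γ := TopologicalSpace.separableSpace_iff_countable.1 inferInstance
  have := P.finite_stabilizer
  obtain ⟨F, hF⟩ := Γ.exists_isFundamentalDomain μ
  rw [hF.covolume_eq_volume, hF.measure_eq_tsum_inv_card
    (fun v w => (isOpen_setOf_aut_apply_eq v w).measurableSet)
    (fun v => (isOpen_stabilizer_aut v).measure_ne_zero μ ⟨1, one_mem _⟩)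
    (fun v => (isCompact_stabilizer_aut hT.preconnected hT' v).measure_ne_top)
    hμ.normalized P.vert P.vert_unique]
  exact tsum_congr fun a => by rw [Nat.card_congr (P.vertEquiv a).toEquiv]

theorem IsSerreHaar.covolume_eq_ofReal {Γ : Subgroup (T ≃g T)} {𝒢 : GraphOfGroups}
    {μ : Measure (T ≃g T)} (hμ : T.IsSerreHaar μ) (P : 𝒢.QuotientPresentation T Γ)
    (hT : T.Connected) (hT' : ∀ v, (T.neighborSet v).Finite) [Fintype 𝒢.Vert]
    [∀ a, Finite (𝒢.vertGroup a)] :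
    covolume Γ (T ≃g T) μ = ENNReal.ofReal (∑ a, 1 / (Nat.card (𝒢.vertGroup a) : ℝ)) := by
  rw [hμ.covolume_eq P hT hT', tsum_fintype,
    ENNReal.ofReal_sum_of_nonneg fun a _ => by positivity]
  refine Finset.sum_congr rfl fun a _ => ?_
  rw [one_div, ENNReal.ofReal_inv_of_pos (by exact_mod_cast Nat.card_pos), ENNReal.ofReal_natCast]

/-- A Haar measure in Serre's normalisation exists as soon as the automorphism group has finitely
many orbits of vertices: any Haar measure may be rescaled. -/
theorem exists_isSerreHaar (hT : T.Connected) (hT' : ∀ v, (T.neighborSet v).Finite)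
    [Finite (MulAction.orbitRel.Quotient (T ≃g T) V)] :
    ∃ μ : Measure (T ≃g T), T.IsSerreHaar μ := by
  obtain ⟨v⟩ := hT.nonempty
  have hcompact := isCompact_stabilizer_aut hT.preconnected hT'
  let K : TopologicalSpace.PositiveCompacts (T ≃g T) :=
    ⟨⟨_, hcompact v⟩, by
      change (interior (MulAction.stabilizer (T ≃g T) v : Set (T ≃g T))).Nonempty
      rw [(isOpen_stabilizer_aut v).interior_eq]
      exact ⟨1, one_mem _⟩⟩
  let ν := Measure.haarMeasure K
  let S := ∑' o : MulAction.orbitRel.Quotient (T ≃g T) V,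
    (ν (MulAction.stabilizer (T ≃g T) o.out : Set (T ≃g T)))⁻¹
  have hS : S ≠ 0 := by
    intro h
    rw [ENNReal.tsum_eq_zero] at h
    have := h (Quotient.mk _ v)
    rw [ENNReal.inv_eq_zero] at this
    exact (hcompact _).measure_ne_top this
  have hS' : S ≠ ∞ := by
    have := Fintype.ofFinite (MulAction.orbitRel.Quotient (T ≃g T) V)
    rw [show S = _ from tsum_fintype _]
    refine (ENNReal.sum_ne_top).2 fun o _ => ENNReal.inv_ne_top.2 ?_
    exact (isOpen_stabilizer_aut _).measure_ne_zero ν ⟨1, one_mem _⟩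
  refine ⟨S • ν, Measure.IsHaarMeasure.smul ν hS hS', ?_⟩
  simp_rw [Measure.smul_apply, smul_eq_mul]
  have : ∀ o : MulAction.orbitRel.Quotient (T ≃g T) V,
      (S * ν (MulAction.stabilizer (T ≃g T) o.out : Set (T ≃g T)))⁻¹ =
      S⁻¹ * (ν (MulAction.stabilizer (T ≃g T) o.out : Set (T ≃g T)))⁻¹ := fun o =>
    ENNReal.mul_inv (Or.inl hS) (Or.inl hS')
  simp_rw [this, ENNReal.tsum_mul_left]
  exact ENNReal.inv_mul_cancel hS hS'

end SimpleGraph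

/-! ### The path and the star as graphs of subgroups -/

namespace Subgroup

variable {G H : Type*} [Group G] [Group H]

lemma relIndex_eq_of_card_eq [Finite G] {K L : Subgroup G} (h : K ≤ L) {d : ℕ}
    (hd : Nat.card L = Nat.card K * d) : K.relIndex L = d := by
  have h1 := relIndex_mul_relIndex ⊥ K L bot_le h
  rw [relIndex_bot_left, relIndex_bot_left, hd] at h1
  exact Nat.eq_of_mul_eq_mul_left Nat.card_pos h1

lemma card_prod (K : Subgroup G) (L : Subgroup H) :
    Nat.card (K.prod L) = Nat.card K * Nat.card L := by
  rw [Nat.card_congr (prodEquiv K L).toEquiv, Nat.card_prod]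

end Subgroup

lemma card_cyc (m : ℕ) : Nat.card (Cyc m) = m := by
  rw [Nat.card_congr Multiplicative.toAdd, Nat.card_zmod]

namespace CyclicPath

variable {n k : ℕ}

lemma card_cycPow {i : ℕ} (hi : i ≤ k) : Nat.card (cycPow n k i) = (n - 1) ^ i := by
  let e : Subgroup.pi {j : Fin k | i ≤ (j : ℕ)} (fun _ => (⊥ : Subgroup (Cyc (n - 1)))) ≃
      (Fin i → Cyc (n - 1)) :=
    { toFun := fun x j => x.1 (Fin.castLE hi j)
      invFun := fun y => ⟨fun j => if h : (j : ℕ) < i then y ⟨j, h⟩ else 1, fun j hj => by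
        have hj : i ≤ (j : ℕ) := hj
        simp [hj.not_gt]⟩
      left_inv := by
        rintro ⟨x, hx⟩
        refine Subtype.ext (funext fun j => ?_)
        by_cases h : (j : ℕ) < i
        · simp [h]
        · exact (dif_neg h).trans (Subgroup.mem_bot.1 (hx j (not_lt.1 h))).symm
      right_inv := fun y => by
        ext j
        simp }
  rw [cycPow, Subgroup.card_prod, Subgroup.card_prod, Nat.card_congr e]
  simp [Nat.card_fun, card_cyc]

lemma card_vertSubgroup_red_zero : Nat.card (vertSubgroup n k (.red 0)) = 2 := by
  simp [vertSubgroup, Subgroup.card_prod]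

lemma card_vertSubgroup_red_succ (i : Fin k) :
    Nat.card (vertSubgroup n k (.red i.succ)) = (n - 1) ^ ((i : ℕ) + 1) := by
  simp [vertSubgroup, card_cycPow (Nat.succ_le_of_lt i.isLt)]

lemma card_vertSubgroup_blue_last :
    Nat.card (vertSubgroup n k (.blue (Fin.last k))) = (n - 1) ^ k * n := by
  simp [vertSubgroup, Subgroup.card_prod, card_cyc, Nat.card_fun, mul_comm]

lemma card_vertSubgroup_blue_castSucc (i : Fin k) :
    Nat.card (vertSubgroup n k (.blue i.castSucc)) = (n - 1) ^ ((i : ℕ) + 1) := by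
  simp [vertSubgroup, i.isLt.ne, card_cycPow (Nat.succ_le_of_lt i.isLt)]

lemma card_edgeSubgroup_up (i : Fin (k + 1)) :
    Nat.card (edgeSubgroup n k (.up i)) = (n - 1) ^ (i : ℕ) :=
  card_cycPow (Nat.le_of_lt_succ i.isLt)

lemma card_edgeSubgroup_flat (i : Fin k) :
    Nat.card (edgeSubgroup n k (.flat i)) = (n - 1) ^ ((i : ℕ) + 1) :=
  card_cycPow (Nat.succ_le_of_lt i.isLt)

lemma fst_eq_one_of_mem_blue {i : Fin (k + 1)} {x : Ambient n k}
    (hx : x ∈ vertSubgroup n k (.blue i)) : x.1 = 1 := by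
  by_cases hi : (i : ℕ) = k
  · simpa [vertSubgroup, hi, Subgroup.mem_prod] using hx
  · have hx : x ∈ cycPow n k (i + 1) := by simpa [vertSubgroup, hi] using hx
    exact hx.1

lemma snd_eq_one_of_mem_red_zero {x : Ambient n k} (hx : x ∈ vertSubgroup n k (.red 0)) :
    x.2 = 1 := by
  simpa [vertSubgroup, Subgroup.mem_prod] using hx

lemma edgeSubgroup_eq (e : Edge k) : edgeSubgroup n k e =
    vertSubgroup n k (endpoint k e false) ⊓ vertSubgroup n k (endpoint k e true) := by
  refine le_antisymm (le_inf (edgeSubgroup_le n k e false) (edgeSubgroup_le n k e true)) ?_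
  rcases e with i | i
  · by_cases hi : (i : ℕ) = 0
    · obtain rfl : i = 0 := Fin.ext hi
      rintro x ⟨h1, h2⟩
      obtain rfl : x = 1 := Prod.ext (fst_eq_one_of_mem_blue h2) (snd_eq_one_of_mem_red_zero h1)
      exact one_mem _
    · exact inf_le_left.trans (by simp [edgeSubgroup, vertSubgroup, endpoint, hi])
  · exact inf_le_left.trans (by simp [edgeSubgroup, vertSubgroup, endpoint])

/-- Red vertices have the colour `false`, blue vertices the colour `true`. -/
def color : Vert k → Bool
  | .red _ => false
  | .blue _ => true

/-- The indices of the edge groups at a vertex of the path add up to the degree of the vertices of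
its colour in the tree. -/
lemma exists_incident_edges (hn : 3 ≤ n) (a : Vert k) :
    ∃ E : Finset (Edge k), (∀ e, e ∈ E ↔ endpoint k e (color a) = a) ∧
      ∑ e ∈ E, (edgeSubgroup n k e).relIndex (vertSubgroup n k a) = if color a then n else 2 := by
  classical
  have : NeZero n := ⟨by omega⟩
  have : NeZero (n - 1) := ⟨by omega⟩
  have hle := edgeSubgroup_le n k
  rcases a with i | i
  · induction i using Fin.cases with
    | zero =>
      refine ⟨{.up 0}, ?_, ?_⟩
      · rintro (j | j) <;> simp [endpoint, color]
      · rw [Finset.sum_singleton]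
        refine Subgroup.relIndex_eq_of_card_eq (hle (.up 0) false) ?_
        rw [card_edgeSubgroup_up]
        exact card_vertSubgroup_red_zero
    | succ i =>
      refine ⟨{.up i.succ, .flat i}, ?_, ?_⟩
      · rintro (j | j) <;> simp [endpoint, color]
      · rw [Finset.sum_pair (by simp),
          Subgroup.relIndex_eq_of_card_eq (L := vertSubgroup n k (.red i.succ)) (d := 1)
            (hle (.up i.succ) false),
          Subgroup.relIndex_eq_of_card_eq (L := vertSubgroup n k (.red i.succ)) (d := 1)
            (hle (.flat i) false)]
        · rfl
        · rw [card_edgeSubgroup_flat, mul_one]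
          exact card_vertSubgroup_red_succ i
        · rw [card_edgeSubgroup_up, mul_one]
          exact card_vertSubgroup_red_succ i
  · induction i using Fin.lastCases with
    | last =>
      refine ⟨{.up (Fin.last k)}, ?_, ?_⟩
      · rintro (j | j) <;> simp [endpoint, color, Fin.castSucc_ne_last]
      · rw [Finset.sum_singleton]
        refine Subgroup.relIndex_eq_of_card_eq (hle (.up (Fin.last k)) true) ?_
        rw [card_edgeSubgroup_up]
        exact card_vertSubgroup_blue_last
    | cast i =>
      refine ⟨{.up i.castSucc, .flat i}, ?_, ?_⟩
      · rintro (j | j) <;> simp [endpoint, color]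
      · rw [Finset.sum_pair (by simp),
          Subgroup.relIndex_eq_of_card_eq (L := vertSubgroup n k (.blue i.castSucc)) (d := n - 1)
            (hle (.up i.castSucc) true),
          Subgroup.relIndex_eq_of_card_eq (L := vertSubgroup n k (.blue i.castSucc)) (d := 1)
            (hle (.flat i) true)]
        · exact Nat.sub_add_cancel (by omega)
        · rw [card_edgeSubgroup_flat, mul_one]
          exact card_vertSubgroup_blue_castSucc i
        · rw [card_edgeSubgroup_up, Fin.val_castSucc, ← pow_succ]
          exact card_vertSubgroup_blue_castSucc i

end CyclicPath

/-- The graph of groups `cyclicPath n k` together with the ambient group of its vertex groups. -/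
def cyclicPathSubgroupGraph (n k : ℕ) : SubgroupGraph (CyclicPath.Ambient n k) where
  Vert := CyclicPath.Vert k
  Edge := CyclicPath.Edge k
  endpoint := CyclicPath.endpoint k
  vertSubgroup := CyclicPath.vertSubgroup n k
  edgeSubgroup := CyclicPath.edgeSubgroup n k
  edgeSubgroup_eq := CyclicPath.edgeSubgroup_eq
  color := CyclicPath.color
  color_endpoint := by rintro (i | i) (_ | _) <;> rfl
  edge_ext := by
    rintro (i | i) (j | j) h
    · have := h false
      simp only [CyclicPath.endpoint, CyclicPath.Vert.red.injEq] at this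
      rw [this]
    · have h1 := h false
      have h2 := h true
      simp only [CyclicPath.endpoint, CyclicPath.Vert.red.injEq,
        CyclicPath.Vert.blue.injEq, Fin.ext_iff] at h1 h2
      simp at h1 h2
      omega
    · have h1 := h false
      have h2 := h true
      simp only [CyclicPath.endpoint, CyclicPath.Vert.red.injEq,
        CyclicPath.Vert.blue.injEq, Fin.ext_iff] at h1 h2
      simp at h1 h2
      omega
    · have := h false
      simp only [CyclicPath.endpoint, CyclicPath.Vert.red.injEq, Fin.succ_inj] at this
      rw [this]

theorem cyclicPath_exists_isQuotientOf {V : Type u} {T : SimpleGraph V} {n : ℕ} (hn : 3 ≤ n)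
    (hT : T.IsBiregularTree n 2) (k : ℕ) :
    ∃ Γ : Subgroup (T ≃g T), (cyclicPath n k).IsQuotientOf T Γ := by
  classical
  have : NeZero n := ⟨by omega⟩
  have : NeZero (n - 1) := ⟨by omega⟩
  refine (cyclicPathSubgroupGraph n k).exists_isQuotientOf (by omega) two_ne_zero hT
    (CyclicPath.Vert.red 0) ?_ ?_ ?_
  · intro P h0 hP
    have hup : ∀ i, P (.red i) → P (.blue i) := fun i => hP (.up i) false
    have hred : ∀ i, P (.red i) := by
      intro i
      induction i using Fin.induction with
      | zero => exact h0
      | succ i ih => exact hP (.flat i) true (hup _ ih)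
    rintro (i | i)
    exacts [hred i, hup i (hred i)]
  · intro g hg
    exact Prod.ext (CyclicPath.fst_eq_one_of_mem_blue (hg (.blue 0)))
      (CyclicPath.snd_eq_one_of_mem_red_zero (hg (.red 0)))
  · exact CyclicPath.exists_incident_edges hn

namespace CyclicStar

variable {n : ℕ}

lemma card_vertSubgroup_center : Nat.card (vertSubgroup n .center) = n - 2 := by
  simp [vertSubgroup, Subgroup.card_prod, card_cyc]

lemma card_vertSubgroup_leaf (i : Fin 3) :
    Nat.card (vertSubgroup n (.leaf i)) = if i = 1 then 2 else 2 * (n - 2) := by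
  by_cases hi : i = 1 <;> simp [vertSubgroup, hi, Subgroup.card_prod, card_cyc]

lemma card_edgeSubgroup (i : Fin 3) :
    Nat.card (edgeSubgroup n i) = if i = 1 then 1 else n - 2 := by
  by_cases hi : i = 1 <;> simp [edgeSubgroup, hi, Subgroup.card_prod, card_cyc]

lemma edgeSubgroup_eq (i : Fin 3) : edgeSubgroup n i =
    vertSubgroup n (endpoint i false) ⊓ vertSubgroup n (endpoint i true) := by
  by_cases hi : i = 1
  · ext x
    simp [edgeSubgroup, vertSubgroup, endpoint, hi, Subgroup.mem_prod, Prod.ext_iff, and_comm]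
  · simp [edgeSubgroup, vertSubgroup, endpoint, hi]

/-- The centre has the colour `true`, the leaves have the colour `false`. -/
def color : Vert → Bool
  | .center => true
  | .leaf _ => false

/-- The indices of the edge groups at a vertex of the star add up to the degree of the vertices of
its colour in the tree. -/
lemma exists_incident_edges (hn : 3 ≤ n) (a : Vert) :
    ∃ E : Finset (Fin 3), (∀ e, e ∈ E ↔ endpoint e (color a) = a) ∧
      ∑ e ∈ E, (edgeSubgroup n e).relIndex (vertSubgroup n a) = if color a then n else 2 := by
  have : NeZero (n - 2) := ⟨by omega⟩
  have hle := edgeSubgroup_le n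
  rcases a with _ | i
  · have h : ∀ i : Fin 3, (edgeSubgroup n i).relIndex (vertSubgroup n .center) =
        if i = 1 then n - 2 else 1 := fun i =>
      Subgroup.relIndex_eq_of_card_eq (hle i true) (by
        rw [card_edgeSubgroup]
        refine card_vertSubgroup_center.trans ?_
        split_ifs <;> simp)
    refine ⟨Finset.univ, fun e => ⟨fun _ => rfl, fun _ => Finset.mem_univ e⟩, ?_⟩
    simp only [h, Fin.sum_univ_three, color]
    simp
    omega
  · refine ⟨{i}, fun e => by simp [endpoint, color], ?_⟩
    rw [Finset.sum_singleton]
    refine Subgroup.relIndex_eq_of_card_eq (hle i false) ?_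
    rw [card_edgeSubgroup]
    refine (card_vertSubgroup_leaf i).trans ?_
    split_ifs <;> simp_all [mul_comm, color]

end CyclicStar

/-- The graph of groups `cyclicStar n` together with the ambient group of its vertex groups. -/
def cyclicStarSubgroupGraph (n : ℕ) : SubgroupGraph (Cyc 2 × Cyc (n - 2)) where
  Vert := CyclicStar.Vert
  Edge := Fin 3
  endpoint := CyclicStar.endpoint
  vertSubgroup := CyclicStar.vertSubgroup n
  edgeSubgroup := CyclicStar.edgeSubgroup n
  edgeSubgroup_eq := CyclicStar.edgeSubgroup_eq
  color := CyclicStar.color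
  color_endpoint := by rintro i (_ | _) <;> rfl
  edge_ext := by
    intro i j h
    exact CyclicStar.Vert.leaf.inj (h false)

theorem cyclicStar_exists_isQuotientOf {V : Type u} {T : SimpleGraph V} {n : ℕ} (hn : 3 ≤ n)
    (hT : T.IsBiregularTree n 2) :
    ∃ Γ : Subgroup (T ≃g T), (cyclicStar n).IsQuotientOf T Γ := by
  have : NeZero (n - 2) := ⟨by omega⟩
  refine (cyclicStarSubgroupGraph n).exists_isQuotientOf (by omega) two_ne_zero hT
    CyclicStar.Vert.center ?_ ?_ ?_
  · intro P h0 hP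
    rintro (_ | i)
    exacts [h0, hP i true h0]
  · intro g hg
    have h1 := hg CyclicStar.Vert.center
    have h2 := hg (CyclicStar.Vert.leaf 1)
    simp only [cyclicStarSubgroupGraph, CyclicStar.vertSubgroup, if_true, Subgroup.mem_prod,
      Subgroup.mem_bot] at h1 h2
    exact Prod.ext h1.1 h2.2
  · exact CyclicStar.exists_incident_edges hn

/-! ### The covolumes of the path and the star -/

lemma pathCovolume_sub {n : ℕ} (hn : 3 ≤ n) (k : ℕ) :
    pathCovolume n k - (1 / 2 + 2 / ((n : ℝ) - 2)) =
      -(((n : ℝ) + 2) / (n * (n - 2))) * (1 / ((n : ℝ) - 1)) ^ k := by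
  have hn' : (3 : ℝ) ≤ n := by exact_mod_cast hn
  have h0 : (n : ℝ) ≠ 0 := by linarith
  have h1 : (n : ℝ) - 1 ≠ 0 := by linarith
  have h2 : (n : ℝ) - 2 ≠ 0 := by linarith
  induction k with
  | zero =>
    simp [pathCovolume]
    field_simp
    ring
  | succ k ih =>
    have hstep : pathCovolume n (k + 1) = pathCovolume n k + 2 * (1 / ((n : ℝ) - 1) ^ (k + 1)) +
        (1 / ((n : ℝ) * ((n : ℝ) - 1) ^ (k + 1)) - 1 / ((n : ℝ) * ((n : ℝ) - 1) ^ k)) := by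
      rw [pathCovolume, pathCovolume, Finset.sum_Icc_succ_top (by omega)]
      ring
    have : pathCovolume n (k + 1) - (1 / 2 + 2 / ((n : ℝ) - 2)) =
        (pathCovolume n k - (1 / 2 + 2 / ((n : ℝ) - 2))) + 2 * (1 / ((n : ℝ) - 1) ^ (k + 1)) +
        (1 / ((n : ℝ) * ((n : ℝ) - 1) ^ (k + 1)) - 1 / ((n : ℝ) * ((n : ℝ) - 1) ^ k)) := by
      rw [hstep]
      ring
    rw [this, ih, one_div_pow, one_div_pow]
    field_simp
    ring

lemma pathCovolume_ne {n : ℕ} (hn : 3 ≤ n) (k : ℕ) :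
    pathCovolume n k - (1 / 2 + 2 / ((n : ℝ) - 2)) ≠ 0 := by
  have hn' : (3 : ℝ) ≤ n := by exact_mod_cast hn
  have h1 : 0 < (n : ℝ) - 1 := by linarith
  have h2 : 0 < (n : ℝ) - 2 := by linarith
  rw [pathCovolume_sub hn]
  have : 0 < ((n : ℝ) + 2) / (n * (n - 2)) * (1 / ((n : ℝ) - 1)) ^ k := by positivity
  linarith

lemma tendsto_pathCovolume {n : ℕ} (hn : 3 ≤ n) :
    Tendsto (fun k => pathCovolume n k) atTop (𝓝 (1 / 2 + 2 / ((n : ℝ) - 2))) := by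
  have hn' : (3 : ℝ) ≤ n := by exact_mod_cast hn
  rw [← tendsto_sub_nhds_zero_iff]
  simp_rw [pathCovolume_sub hn]
  rw [← mul_zero (-(((n : ℝ) + 2) / (n * (n - 2))))]
  refine (tendsto_pow_atTop_nhds_zero_of_lt_one ?_ ?_).const_mul _
  · exact one_div_nonneg.2 (by linarith)
  · rw [div_lt_one] <;> linarith

lemma pathCovolume_rate {n : ℕ} (hn : 3 ≤ n) (k : ℕ) :
    |pathCovolume n (k + 1) - (1 / 2 + 2 / ((n : ℝ) - 2))| /
      |pathCovolume n k - (1 / 2 + 2 / ((n : ℝ) - 2))| = 1 / ((n : ℝ) - 1) := by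
  have hn' : (3 : ℝ) ≤ n := by exact_mod_cast hn
  have h : pathCovolume n (k + 1) - (1 / 2 + 2 / ((n : ℝ) - 2)) =
      1 / ((n : ℝ) - 1) * (pathCovolume n k - (1 / 2 + 2 / ((n : ℝ) - 2))) := by
    rw [pathCovolume_sub hn, pathCovolume_sub hn, pow_succ]
    ring
  rw [h, abs_mul, mul_div_assoc, div_self (abs_ne_zero.2 (pathCovolume_ne hn k)), mul_one,
    abs_of_nonneg (one_div_nonneg.2 (by linarith))]

lemma pathCovolume_nonneg {n : ℕ} (hn : 3 ≤ n) (k : ℕ) : 0 ≤ pathCovolume n k := by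
  have hn' : (3 : ℝ) ≤ n := by exact_mod_cast hn
  have h1 : 0 < (n : ℝ) - 1 := by linarith
  unfold pathCovolume
  positivity

/-- The vertices of the path, listed by colour. -/
def CyclicPath.vertEquiv (k : ℕ) : Fin (k + 1) ⊕ Fin (k + 1) ≃ CyclicPath.Vert k where
  toFun := Sum.elim .red .blue
  invFun
    | .red i => .inl i
    | .blue i => .inr i
  left_inv := by rintro (i | i) <;> rfl
  right_inv := by rintro (i | i) <;> rfl

instance (k : ℕ) : Fintype (CyclicPath.Vert k) := Fintype.ofEquiv _ (CyclicPath.vertEquiv k)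

lemma sum_one_div_card_cyclicPath {n : ℕ} (hn : 3 ≤ n) (k : ℕ) :
    ∑ a, 1 / (Nat.card (CyclicPath.vertSubgroup n k a) : ℝ) = pathCovolume n k := by
  rw [← (CyclicPath.vertEquiv k).sum_comp, Fintype.sum_sum_type, Fin.sum_univ_succ,
    Fin.sum_univ_castSucc (n := k)]
  simp only [CyclicPath.vertEquiv, Equiv.coe_fn_mk, Sum.elim_inl, Sum.elim_inr,
    CyclicPath.card_vertSubgroup_red_zero, CyclicPath.card_vertSubgroup_red_succ,
    CyclicPath.card_vertSubgroup_blue_last, CyclicPath.card_vertSubgroup_blue_castSucc]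
  have h : ∀ f : ℕ → ℝ, ∑ i : Fin k, f ((i : ℕ) + 1) = ∑ i ∈ Finset.Icc 1 k, f i := by
    intro f
    rw [Fin.sum_univ_eq_sum_range fun i => f (i + 1), Finset.range_eq_Ico,
      Finset.sum_Ico_add' f 0 k 1]
    rfl
  push_cast [Nat.cast_sub (show 1 ≤ n by omega)]
  rw [h fun i => 1 / ((n : ℝ) - 1) ^ i, pathCovolume]
  ring

/-- The vertices of the star, the centre being `none`. -/
def CyclicStar.vertEquiv : Option (Fin 3) ≃ CyclicStar.Vert where
  toFun
    | none => .center
    | some i => .leaf i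
  invFun
    | .center => none
    | .leaf i => some i
  left_inv := by rintro (_ | i) <;> rfl
  right_inv := by rintro (_ | i) <;> rfl

instance : Fintype CyclicStar.Vert := Fintype.ofEquiv _ CyclicStar.vertEquiv

lemma sum_one_div_card_cyclicStar {n : ℕ} (hn : 3 ≤ n) :
    ∑ a, 1 / (Nat.card (CyclicStar.vertSubgroup n a) : ℝ) = 1 / 2 + 2 / ((n : ℝ) - 2) := by
  have hn' : (3 : ℝ) ≤ n := by exact_mod_cast hn
  have h2 : (n : ℝ) - 2 ≠ 0 := by linarith
  rw [← CyclicStar.vertEquiv.sum_comp, Fintype.sum_option, Fin.sum_univ_three]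
  simp only [CyclicStar.vertEquiv, Equiv.coe_fn_mk, CyclicStar.card_vertSubgroup_center,
    CyclicStar.card_vertSubgroup_leaf]
  simp [Nat.cast_sub (show 2 ≤ n by omega)]
  field_simp
  ring

/-! ### Lattices in the automorphism group of a biregular tree -/

namespace SimpleGraph.IsBiregularTree

variable {V : Type u} {T : SimpleGraph V}

lemma finite_neighborSet {n m : ℕ} (hT : T.IsBiregularTree n m) (v : V) :
    (T.neighborSet v).Finite := by
  obtain ⟨c, hc⟩ := hT.biregular
  rw [← Set.encard_lt_top_iff, hc]
  split_ifs <;> exact ENat.natCast_lt_top _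

lemma exists_isUniformLattice {n m : ℕ} (hT : T.IsBiregularTree n m) {𝒢 : GraphOfGroups}
    [Fintype 𝒢.Vert] [∀ a, Finite (𝒢.vertGroup a)]
    (h𝒢 : ∃ Γ : Subgroup (T ≃g T), 𝒢.IsQuotientOf T Γ) {μ : Measure (T ≃g T)}
    (hμ : T.IsSerreHaar μ) :
    ∃ Γ : Subgroup (T ≃g T), IsUniformLattice Γ ∧ 𝒢.IsQuotientOf T Γ ∧
      covolume Γ (T ≃g T) μ = ENNReal.ofReal (∑ a, 1 / (Nat.card (𝒢.vertGroup a) : ℝ)) := by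
  obtain ⟨Γ, ⟨P⟩⟩ := h𝒢
  exact ⟨Γ, P.isUniformLattice hT.isTree.1 hT.finite_neighborSet, ⟨P⟩,
    hμ.covolume_eq_ofReal P hT.isTree.1 hT.finite_neighborSet⟩

end SimpleGraph.IsBiregularTree

/-- A set of reals which contains a sequence and its limit, but in which the sequence avoids the
limit, is not discrete. -/
lemma not_discreteTopology_of_tendsto {S : Set ℝ} {u : ℕ → ℝ} {x : ℝ} (hu : ∀ k, u k ∈ S)
    (hx : x ∈ S) (hne : ∀ k, u k ≠ x) (hlim : Tendsto u atTop (𝓝 x)) : ¬ DiscreteTopology S := by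
  intro h
  have h1 : Tendsto (fun k => (⟨u k, hu k⟩ : S)) atTop (𝓝 ⟨x, hx⟩) := tendsto_subtype_rng.2 hlim
  rw [nhds_discrete, tendsto_pure] at h1
  obtain ⟨k, hk⟩ := h1.exists
  exact hne k (congrArg Subtype.val hk)

theorem mainTheorem5 {V : Type u} (T : SimpleGraph V) (n : ℕ) (hn : 3 ≤ n)
    (hT : T.IsBiregularTree n 2) :
    (∃ μ : Measure (T ≃g T), T.IsSerreHaar μ) ∧
    ∀ μ : Measure (T ≃g T), T.IsSerreHaar μ →
      ¬ DiscreteTopology (T.uniformCovolumes μ) ∧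
      (∀ k : ℕ, ∃ Γ : Subgroup (T ≃g T), IsUniformLattice Γ ∧
        (cyclicPath n k).IsQuotientOf T Γ ∧
        covolume Γ (T ≃g T) μ = ENNReal.ofReal (pathCovolume n k)) ∧
      Tendsto (fun k => pathCovolume n k) atTop (𝓝 (1 / 2 + 2 / ((n : ℝ) - 2))) ∧
      Tendsto (fun k => |pathCovolume n (k + 1) - (1 / 2 + 2 / ((n : ℝ) - 2))| /
        |pathCovolume n k - (1 / 2 + 2 / ((n : ℝ) - 2))|) atTop (𝓝 (1 / ((n : ℝ) - 1))) ∧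
      (∃ Γ : Subgroup (T ≃g T), IsUniformLattice Γ ∧
        (cyclicStar n).IsQuotientOf T Γ ∧
        covolume Γ (T ≃g T) μ = ENNReal.ofReal (1 / 2 + 2 / ((n : ℝ) - 2))) := by
  have : NeZero n := ⟨by omega⟩
  have : NeZero (n - 1) := ⟨by omega⟩
  have : NeZero (n - 2) := ⟨by omega⟩
  have hstar := cyclicStar_exists_isQuotientOf hn hT
  have : Finite (cyclicStar n).Vert := inferInstanceAs (Finite CyclicStar.Vert)
  have hfinStar : ∀ a, Finite ((cyclicStar n).vertGroup a) := fun a =>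
    inferInstanceAs (Finite (CyclicStar.vertSubgroup n a))
  have hfinPath : ∀ k a, Finite ((cyclicPath n k).vertGroup a) := fun k a =>
    inferInstanceAs (Finite (CyclicPath.vertSubgroup n k a))
  refine ⟨?_, fun μ hμ => ?_⟩
  · obtain ⟨Γ, ⟨P⟩⟩ := hstar
    have := P.finite_orbits
    exact SimpleGraph.exists_isSerreHaar hT.isTree.1 hT.finite_neighborSet
  have hpath : ∀ k : ℕ, ∃ Γ : Subgroup (T ≃g T), IsUniformLattice Γ ∧
      (cyclicPath n k).IsQuotientOf T Γ ∧
      covolume Γ (T ≃g T) μ = ENNReal.ofReal (pathCovolume n k) := by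
    intro k
    let : Fintype (cyclicPath n k).Vert := inferInstanceAs (Fintype (CyclicPath.Vert k))
    rw [← sum_one_div_card_cyclicPath hn k]
    exact hT.exists_isUniformLattice (cyclicPath_exists_isQuotientOf hn hT k) hμ
  have hlimit : ∃ Γ : Subgroup (T ≃g T), IsUniformLattice Γ ∧
      (cyclicStar n).IsQuotientOf T Γ ∧
      covolume Γ (T ≃g T) μ = ENNReal.ofReal (1 / 2 + 2 / ((n : ℝ) - 2)) := by
    let : Fintype (cyclicStar n).Vert := inferInstanceAs (Fintype CyclicStar.Vert)
    rw [← sum_one_div_card_cyclicStar hn]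
    exact hT.exists_isUniformLattice hstar hμ
  refine ⟨?_, hpath, tendsto_pathCovolume hn, ?_, hlimit⟩
  · refine not_discreteTopology_of_tendsto (u := fun k => pathCovolume n k) (fun k => ?_) ?_
      (fun k => sub_ne_zero.1 (pathCovolume_ne hn k)) (tendsto_pathCovolume hn)
    · obtain ⟨Γ, h1, -, h2⟩ := hpath k
      exact ⟨Γ, h1, by rw [h2, ENNReal.toReal_ofReal (pathCovolume_nonneg hn k)]⟩
    · obtain ⟨Γ, h1, -, h2⟩ := hlimit
      refine ⟨Γ, h1, ?_⟩
      rw [h2, ENNReal.toReal_ofReal]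
      exact ge_of_tendsto' (tendsto_pathCovolume hn) (pathCovolume_nonneg hn)
  · simp_rw [pathCovolume_rate hn]
    exact tendsto_const_nhds
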